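/- Computational model. Programs run on a probabilistic real RAM: finite structured programs over natural-number and real variables and arrays, with unit cost for each instruction and each comparison. The natural-number instructions are assignment of constants, addition, truncated subtraction and array access; the real ones are assignment of rational constants, conversion from naturals, $+,-,\times,/,\log$ and array access. A program can read any entry of its input tables in one step, write to an output memory, and draw a uniform element of $[0,1]$ or a uniform element of $\{0,\dots,m-1\}$ in one step. Queries. For $S\in\{0,1\}^d$ let $d_S(x)=\bigvee_{i:S(i)=1}x_i$ and $c_S(x)=\bigwedge_{i:S(i)=1}x_i$ be the monotone disjunction and the monotone conjunction on $\{0,1\}^d$ (with $d_\emptyset=0$, $c_\emptyset=1$). For a query $q$ and a data set $D=(x_1,\dots,x_n)\in(\{0,1\}^d)^n$, write $|D|=n$ and $q(D)=\frac1n\sum_{i=1}^n q(x_i)$. Two data sets of the same size are adjacent if they differ in at most one entry. A randomized mechanism $M$ is $\varepsilon$-differentially private if $\Pr[M(D)\in E]\le e^{\varepsilon}\Pr[M(D')\in E]$ for all adjacent $D,D'$ and all measurable $E$. Theorem. There is a constant $C>0$ such that, with $$t(\alpha,\beta)=C\,\min(\alpha,1)^{-2}\,\log\bigl(2/\min(\beta,1)\bigr)$$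 (so $t(\alpha,\beta)=O(\alpha^{-2}\log(1/\beta))$ uniformly for $\alpha\in(0,1]$ and $\beta\in(0,1/2]$), the following holds both for the family $q_S=d_S$ of all monotone disjunctions and for the family $q_S=c_S$ of all monotone conjunctions. There are a randomized release program $P$ and a deterministic answering program $Q$ such that for all $\alpha,\beta,\varepsilon>0$, every $d\ge 2$ and every product distribution $\mathcal D$ on $\{0,1\}^d$: 1. On input $\alpha,\beta,\varepsilon,d$, the marginals of $\mathcal D$, and a data set $D\in(\{0,1\}^d)^n$ (any $n$), $P$ outputs a synopsis $y$, and the mechanism $D\mapsto y$ is $\varepsilon$-differentially private. 2. $P$ always halts within $d^{t(\alpha,\beta)}$ steps. Given $\alpha,\beta,\varepsilon,d$, the marginals of $\mathcal D$, a synopsis $y$ output by $P$, and any $S\in\{0,1\}^d$ (but not $D$), $Q$ computes an answer $A_y(S)$ within $d^{t(\alpha,\beta)}$ steps. 3. If $|D|\ge d^{t(\alpha,\beta)}/\varepsilon$, then with probability at least $1-\beta$ over the randomness of $P$, the answers $(\alpha,\beta)$-release the family over $\mathcal D$, that is, $$\Pr_{S\sim\mathcal D}\bigl[\,|q_S(D)-A_y(S)|\le\alpha\,\bigr]\ge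 1-\beta.$$ -/

import Mathlib

open MeasureTheory

/-! ### A probabilistic real RAM with a step count

Programs are structured imperative programs over natural-number and real-number variables and
arrays. A program is a finite object: variables and arrays are named by fixed numerals, and the only
real constants are rational. Arithmetic on naturals is restricted to addition and truncated
subtraction, and there is no rounding of reals, so unit cost per instruction is the usual
convention. Randomness comes from a tape of independent uniform elements of `[0,1]`. -/

/-- The infinite tape of random numbers. -/
abbrev Tape : Type := ℕ → unitInterval

/-- The tape's entries are independent and uniform on `[0,1]`. -/
noncomputable def tapeMeasure : Measure Tape :=
  Measure.infinitePi fun _ : ℕ => (volume : Measure unitInterval)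

/-- The input of a program: initial values of the variables, and read-only two-dimensional
real-valued tables `table k`, with random access. -/
structure Input where
  natInit : ℕ → ℕ
  realInit : ℕ → ℝ
  table : ℕ → ℕ → ℕ → ℝ

/-- A state of the machine: variables, arrays (`natArr k i` is the `i`-th cell of array `k`), the
write-only output memory, and the number of tape cells already consumed. -/
structure State where
  natVar : ℕ → ℕ
  realVar : ℕ → ℝ
  natArr : ℕ → ℕ → ℕ
  realArr : ℕ → ℕ → ℝ
  out : ℕ → ℝ
  used : ℕ

/-- The initial state on a given input. -/
def Input.start (inp : Input) : State where
  natVar := inp.natInit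
  realVar := inp.realInit
  natArr := fun _ _ => 0
  realArr := fun _ _ => 0
  out := fun _ => 0
  used := 0

/-- The instructions. The arguments `a b c` are names of variables, and `k` is the name of an array
or of a table, except in `natConst`, where it is the constant to be stored. -/
inductive Instr : Type
  | natConst (a k : ℕ)
  | natAdd (a b c : ℕ)
  | natSub (a b c : ℕ)
  | natLoad (a k b : ℕ)
  | natStore (k a b : ℕ)
  | natRand (a b : ℕ)
  | realConst (a : ℕ) (r : ℚ)
  | realOfNat (a b : ℕ)
  | realAdd (a b c : ℕ)
  | realSub (a b c : ℕ)
  | realMul (a b c : ℕ)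
  | realDiv (a b c : ℕ)
  | realLog (a b : ℕ)
  | realLoad (a k b : ℕ)
  | realStore (k a b : ℕ)
  | realRand (a : ℕ)
  | read (a k b c : ℕ)
  | write (a b : ℕ)

/-- Assignment to a natural-number variable. -/
def State.setNat (s : State) (a v : ℕ) : State :=
  { s with natVar := Function.update s.natVar a v }

/-- Assignment to a real variable. -/
def State.setReal (s : State) (a : ℕ) (v : ℝ) : State :=
  { s with realVar := Function.update s.realVar a v }

/-- The effect of one instruction. Division by zero returns `0`, and the logarithm of a number `x`
is the natural logarithm of `|x|` (and `0` for `x = 0`). -/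
noncomputable def Instr.exec (inp : Input) (ω : Tape) (s : State) : Instr → State
  | .natConst a k => s.setNat a k
  | .natAdd a b c => s.setNat a (s.natVar b + s.natVar c)
  | .natSub a b c => s.setNat a (s.natVar b - s.natVar c)
  | .natLoad a k b => s.setNat a (s.natArr k (s.natVar b))
  | .natStore k a b =>
      { s with
        natArr :=
          Function.update s.natArr k (Function.update (s.natArr k) (s.natVar a) (s.natVar b)) }
  -- a uniform element of `{0, …, m - 1}`, where `m` is the value of variable `b`
  | .natRand a b =>
      { s with
        natVar :=
          Function.update s.natVar a (min ⌊(ω s.used : ℝ) * (s.natVar b : ℝ)⌋₊ (s.natVar b - 1))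
        used := s.used + 1 }
  | .realConst a r => s.setReal a r
  | .realOfNat a b => s.setReal a (s.natVar b)
  | .realAdd a b c => s.setReal a (s.realVar b + s.realVar c)
  | .realSub a b c => s.setReal a (s.realVar b - s.realVar c)
  | .realMul a b c => s.setReal a (s.realVar b * s.realVar c)
  | .realDiv a b c => s.setReal a (s.realVar b / s.realVar c)
  | .realLog a b => s.setReal a (Real.log (s.realVar b))
  | .realLoad a k b => s.setReal a (s.realArr k (s.natVar b))
  | .realStore k a b =>
      { s with
        realArr :=
          Function.update s.realArr k (Function.update (s.realArr k) (s.natVar a) (s.realVar b)) }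
  -- a uniform element of `[0,1]`
  | .realRand a =>
      { s with realVar := Function.update s.realVar a (ω s.used : ℝ), used := s.used + 1 }
  | .read a k b c => s.setReal a (inp.table k (s.natVar b) (s.natVar c))
  | .write a b => { s with out := Function.update s.out (s.natVar a) (s.realVar b) }

/-- Tests: strict comparison of two natural-number or of two real variables. -/
inductive Test : Type
  | natLT (a b : ℕ)
  | realLT (a b : ℕ)

/-- The truth value of a test. -/
def Test.Holds (s : State) : Test → Prop
  | .natLT a b => s.natVar a < s.natVar b
  | .realLT a b => s.realVar a < s.realVar b

/-- Programs. -/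
inductive Prog : Type
  | instr (i : Instr)
  | seq (c₁ c₂ : Prog)
  | cond (b : Test) (c₁ c₂ : Prog)
  | loop (b : Test) (c : Prog)

/-- `Exec inp ω c s m s'`: on input `inp` with random tape `ω`, the program `c` started in state `s`
halts in state `s'` after exactly `m` steps. Every instruction and every evaluation of a test is one
step. -/
inductive Exec (inp : Input) (ω : Tape) : Prog → State → ℕ → State → Prop
  | instr (i : Instr) (s : State) : Exec inp ω (.instr i) s 1 (i.exec inp ω s)
  | seq {c₁ c₂ : Prog} {s s' s'' : State} {m n : ℕ} :
      Exec inp ω c₁ s m s' → Exec inp ω c₂ s' n s'' → Exec inp ω (.seq c₁ c₂) s (m + n) s''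
  | condTrue {b : Test} {c₁ c₂ : Prog} {s s' : State} {m : ℕ} :
      b.Holds s → Exec inp ω c₁ s m s' → Exec inp ω (.cond b c₁ c₂) s (1 + m) s'
  | condFalse {b : Test} {c₁ c₂ : Prog} {s s' : State} {m : ℕ} :
      ¬ b.Holds s → Exec inp ω c₂ s m s' → Exec inp ω (.cond b c₁ c₂) s (1 + m) s'
  | loopTrue {b : Test} {c : Prog} {s s' s'' : State} {m n : ℕ} :
      b.Holds s → Exec inp ω c s m s' → Exec inp ω (.loop b c) s' n s'' →
      Exec inp ω (.loop b c) s (1 + m + n) s''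
  | loopFalse {b : Test} {c : Prog} {s : State} :
      ¬ b.Holds s → Exec inp ω (.loop b c) s 1 s

/-- The semantics is deterministic once the tape is fixed. -/
theorem Exec.deterministic {inp : Input} {ω : Tape} {c : Prog} {s s₁ s₂ : State} {m₁ m₂ : ℕ}
    (h₁ : Exec inp ω c s m₁ s₁) (h₂ : Exec inp ω c s m₂ s₂) : m₁ = m₂ ∧ s₁ = s₂ := by
  induction h₁ generalizing m₂ s₂ with
  | instr i s => cases h₂; exact ⟨rfl, rfl⟩
  | seq _ _ ih₁ ih₂ =>
    cases h₂ with
    | seq k₁ k₂ =>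
      obtain ⟨rfl, rfl⟩ := ih₁ k₁
      obtain ⟨rfl, rfl⟩ := ih₂ k₂
      exact ⟨rfl, rfl⟩
  | condTrue hb _ ih =>
    cases h₂ with
    | condTrue _ k => obtain ⟨rfl, rfl⟩ := ih k; exact ⟨rfl, rfl⟩
    | condFalse hb' _ => exact absurd hb hb'
  | condFalse hb _ ih =>
    cases h₂ with
    | condTrue hb' _ => exact absurd hb' hb
    | condFalse _ k => obtain ⟨rfl, rfl⟩ := ih k; exact ⟨rfl, rfl⟩
  | loopTrue hb _ _ ih₁ ih₂ =>
    cases h₂ with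
    | loopTrue _ k₁ k₂ =>
      obtain ⟨rfl, rfl⟩ := ih₁ k₁
      obtain ⟨rfl, rfl⟩ := ih₂ k₂
      exact ⟨rfl, rfl⟩
    | loopFalse hb' => exact absurd hb hb'
  | loopFalse hb =>
    cases h₂ with
    | loopTrue hb' _ _ => exact absurd hb' hb
    | loopFalse _ => exact ⟨rfl, rfl⟩

/-- The program halts on the input, with the given tape, after at most `T` steps. -/
def Prog.HaltsWithin (P : Prog) (inp : Input) (ω : Tape) (T : ℝ) : Prop :=
  ∃ (m : ℕ) (s : State), Exec inp ω P inp.start m s ∧ (m : ℝ) ≤ T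

open Classical in
/-- The contents of the output memory when the program halts (`0` if it does not halt). -/
noncomputable def Prog.output (P : Prog) (inp : Input) (ω : Tape) : ℕ → ℝ :=
  if h : ∃ (s : State) (m : ℕ), Exec inp ω P inp.start m s then h.choose.out else 0

theorem Prog.output_eq {P : Prog} {inp : Input} {ω : Tape} {m : ℕ} {s : State}
    (h : Exec inp ω P inp.start m s) : P.output inp ω = s.out := by
  have h' : ∃ (s : State) (m : ℕ), Exec inp ω P inp.start m s := ⟨s, m, h⟩
  obtain ⟨m', hm'⟩ := h'.choose_spec
  rw [Prog.output, dif_pos h', (hm'.deterministic h).2]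

/-! ### Differential privacy and query release -/

/-- Two data sets of the same size are adjacent if they differ in at most one entry. -/
def Adjacent {X : Type*} {n : ℕ} (D D' : Fin n → X) : Prop :=
  ∃ i, ∀ j, j ≠ i → D j = D' j

/-- A randomized mechanism `M` on data sets of all sizes, with randomness drawn from the tape,
satisfies `ε`-differential privacy. -/
def IsDifferentiallyPrivate {X R : Type*} [MeasurableSpace R] (ε : ℝ)
    (M : (n : ℕ) → (Fin n → X) → Tape → R) : Prop :=
  ∀ (n : ℕ) (D D' : Fin n → X), Adjacent D D' → ∀ E : Set R, MeasurableSet E →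
    tapeMeasure {ω | M n D ω ∈ E} ≤ ENNReal.ofReal (Real.exp ε) * tapeMeasure {ω | M n D' ω ∈ E}

/-- The answer `q(D)` to a counting query. -/
noncomputable def countingQuery {X : Type*} (q : X → ℝ) {n : ℕ} (D : Fin n → X) : ℝ :=
  (1 / (n : ℝ)) * ∑ i, q (D i)

/-- For every dimension `d`, a family of counting queries on `{0,1}^d` indexed by the subsets
`S ∈ {0,1}^d` of the set of attributes. -/
abbrev QueryFamily : Type := (d : ℕ) → (Fin d → Bool) → (Fin d → Bool) → ℝ

/-- The monotone Boolean disjunctions `x ↦ ⋁_{i ∈ S} x_i`. -/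
noncomputable def monotoneDisjunctions : QueryFamily := fun d S x =>
  if ∃ i : Fin d, S i = true ∧ x i = true then 1 else 0

/-- The monotone Boolean conjunctions `x ↦ ⋀_{i ∈ S} x_i`. -/
noncomputable def monotoneConjunctions : QueryFamily := fun d S x =>
  if ∀ i : Fin d, S i = true → x i = true then 1 else 0

/-- The answers `ans` are within `α` of the true answers on `D`, except for a set of queries `S` of
`ν`-probability at most `β`. -/
def Releases {X Q : Type*} [MeasurableSpace Q] (α β : ℝ) (q : Q → X → ℝ) {n : ℕ} (D : Fin n → X)
    (ν : Measure Q) (ans : Q → ℝ) : Prop :=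
  1 - β ≤ ν.real {S | |countingQuery (q S) D - ans S| ≤ α}

/-! ### Inputs of the release program and of the answering program -/

/-- A list of bits as a read-only row of zeros and ones. -/
def bitRow {d : ℕ} (x : Fin d → Bool) (j : ℕ) : ℝ :=
  if h : j < d then (if x ⟨j, h⟩ = true then 1 else 0) else 0

/-- The marginal probabilities that describe a product distribution on `{0,1}^d`, as a row. -/
noncomputable def marginalRow {d : ℕ} (μ : Fin d → Measure Bool) (j : ℕ) : ℝ :=
  if h : j < d then (μ ⟨j, h⟩).real {true} else 0

/-- Input of the release program: `d` and `n = |D|` in the first two natural variables, `α, β, ε` in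
the first three real variables, the data set in table `0`, and the marginals of the product
distribution in row `0` of table `1`. -/
noncomputable def releaseInput (α β ε : ℝ) {d : ℕ} (μ : Fin d → Measure Bool) {n : ℕ}
    (D : Fin n → Fin d → Bool) : Input where
  natInit := fun a => if a = 0 then d else if a = 1 then n else 0
  realInit := fun a => if a = 0 then α else if a = 1 then β else if a = 2 then ε else 0
  table := fun k i j =>
    if k = 0 then (if h : i < n then bitRow (D ⟨i, h⟩) j else 0)
    else if k = 1 ∧ i = 0 then marginalRow μ j
    else 0

/-- Input of the answering program: the parameters as for the release program, the query `S` in row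
`0` of table `0`, the marginals in row `0` of table `1`, and the synopsis in row `0` of table `2`.
The data set is not part of it. -/
noncomputable def answerInput (α β ε : ℝ) {d : ℕ} (μ : Fin d → Measure Bool) (y : ℕ → ℝ)
    (S : Fin d → Bool) : Input where
  natInit := fun a => if a = 0 then d else 0
  realInit := fun a => if a = 0 then α else if a = 1 then β else if a = 2 then ε else 0
  table := fun k i j =>
    if k = 0 ∧ i = 0 then bitRow S j
    else if k = 1 ∧ i = 0 then marginalRow μ j
    else if k = 2 ∧ i = 0 then y j
    else 0

/-- The tape of the answering program, which gets no randomness. -/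
def zeroTape : Tape := fun _ => 0

/-- The synopsis (data structure) that the release program `P` outputs. -/
noncomputable def synopsis (P : Prog) (α β ε : ℝ) {d : ℕ} (μ : Fin d → Measure Bool) (n : ℕ)
    (D : Fin n → Fin d → Bool) (ω : Tape) : ℕ → ℝ :=
  P.output (releaseInput α β ε μ D) ω

/-- The answer to the query `S` that the answering program `Q` computes from a synopsis. -/
noncomputable def answer (Q : Prog) (α β ε : ℝ) {d : ℕ} (μ : Fin d → Measure Bool) (y : ℕ → ℝ)
    (S : Fin d → Bool) : ℝ :=
  Q.output (answerInput α β ε μ y S) zeroTape 0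

/-- The exponent `t(α,β)`: it is `C α⁻² log (2/β)` for `α, β ∈ (0,1]`, hence at most
`2 C α⁻² log (1/β)` for `β ≤ 1/2`; parameters above `1` are treated like `1`. -/
noncomputable def timeExponent (C α β : ℝ) : ℝ :=
  C * (1 / (min α 1) ^ 2) * Real.log (2 / min β 1)

/-! Put z_i = x_i for disjunctions and z_i = 1 - x_i for conjunctions. Up to an affine map, the
query S on the entry x is then ∏ (1 - z_i S_i), the indicator that s = ∑ z_i S_i vanishes. The proof
approximates this indicator by a polynomial in s, in mean square over the random query, and
estimates the polynomial from randomized responses.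

Approximation. The polynomial ∏_{j<k} (1 - s/(j+1)) is 1 at s = 0 and, up to sign, the binomial
coefficient of s - 1 over k at s ≥ 1, so its squared error is at most 8^s / 2^k
(`indicatorPoly_error`). Under a product distribution with marginals p_i, the mean of 8^s is ∏ (1 +
7 z_i p_i) ≤ w^(-7), where w = ∏ (1 - z_i p_i) is the probability that s = 0. If w is below a cutoff
x, the entry is replaced by zero at a mean squared cost of w; otherwise 2^k ≥ x^(-8) brings the
error down to x (`approx_error`). So k is about 8 log₂(1/x), whatever d and the marginals are.

Estimation. A factor 1 - s/(j+1) is the mean, over a uniform t in {0, …, d}, of a coefficient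
depending on S times z_t, where z_d = 1. Hence the polynomial is the mean, over a uniform k-tuple,
of a number known from S times a product of k literals (`sum_tupleFactor_mul`). A round releases
such a tuple and the product for a random entry, padded by n constant ones and n constant zeros;
decoding the bit v as 3v - 1 cancels the padding in the mean (`sum_noisyBit`). A contribution is at
most 2(d+1)^k in absolute value, so m = ⌈4(d+1)^(2k)/x⌉ rounds bring the variance below x, and the
total mean squared error is at most 4x (`sum_queryError_le`). With x = (αβ)²/4 this is α²β², which
Markov's inequality splits once over the random choices and once over the query.

Privacy. The padding makes either bit occur for at least n of the 3n indices, so changing one entry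
changes the frequency of a record by a factor of at most 1 + 1/n (`card_fiber_le`). Over m
independent rounds this gives (1 + 1/n)^m ≤ e^(m/n) ≤ e^ε (`card_filter_comp_le`), and the program
outputs zeros unless n is large enough.

Running time. Everything is polynomial in m, k and d. The factor α^(-2) in the exponent serves only
as a generous bound for log(1/α) (`releaseTime_le`). -/

set_option linter.unusedSimpArgs false

/-! ### A Hoare logic with step counts -/

/-- Started in `s`, the program `c` halts within `B` steps in a state with property `Post`. -/
def Runs (inp : Input) (ω : Tape) (c : Prog) (s : State) (B : ℕ) (Post : State → Prop) : Prop :=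
  ∃ (m : ℕ) (s' : State), Exec inp ω c s m s' ∧ m ≤ B ∧ Post s'

/-- A nonempty straight-line program. -/
def straight : Instr → List Instr → Prog
  | i, [] => .instr i
  | i, j :: l => .seq (.instr i) (straight j l)

section Hoare

variable {inp : Input} {ω : Tape} {c c₁ c₂ : Prog} {s : State} {B B₁ B₂ : ℕ}
  {Post Mid : State → Prop} {b : Test}

theorem Runs.mono {B' : ℕ} {Post' : State → Prop} (h : Runs inp ω c s B Post) (hB : B ≤ B')
    (hP : ∀ s, Post s → Post' s) : Runs inp ω c s B' Post' := by
  obtain ⟨m, s', h1, h2, h3⟩ := h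
  exact ⟨m, s', h1, h2.trans hB, hP _ h3⟩

theorem exec_straight (i : Instr) (l : List Instr) (s : State) :
    Exec inp ω (straight i l) s (l.length + 1) ((i :: l).foldl (fun s i => i.exec inp ω s) s) := by
  induction l generalizing i s with
  | nil => exact Exec.instr i s
  | cons j l ih =>
    have := Exec.seq (Exec.instr (inp := inp) (ω := ω) i s) (ih j (i.exec inp ω s))
    rw [add_comm 1] at this
    exact this

theorem Runs.straight {i : Instr} {l : List Instr} (hB : l.length + 1 ≤ B)
    (h : Post ((i :: l).foldl (fun s i => i.exec inp ω s) s)) :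
    Runs inp ω (straight i l) s B Post :=
  ⟨_, _, exec_straight i l s, hB, h⟩

theorem Runs.seq (h₁ : Runs inp ω c₁ s B₁ Mid) (h₂ : ∀ s, Mid s → Runs inp ω c₂ s B₂ Post) :
    Runs inp ω (.seq c₁ c₂) s (B₁ + B₂) Post := by
  obtain ⟨m, s', e1, l1, p1⟩ := h₁
  obtain ⟨m', s'', e2, l2, p2⟩ := h₂ s' p1
  exact ⟨_, _, .seq e1 e2, by omega, p2⟩

theorem Runs.cond (h₁ : b.Holds s → Runs inp ω c₁ s B Post)
    (h₂ : ¬ b.Holds s → Runs inp ω c₂ s B Post) : Runs inp ω (.cond b c₁ c₂) s (1 + B) Post := by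
  by_cases hb : b.Holds s
  · obtain ⟨m, s', e, l, p⟩ := h₁ hb
    exact ⟨_, _, .condTrue hb e, by omega, p⟩
  · obtain ⟨m, s', e, l, p⟩ := h₂ hb
    exact ⟨_, _, .condFalse hb e, by omega, p⟩

/-- The rule for a loop with `N` iterations and the invariant `I`. -/
theorem Runs.loop (I : ℕ → State → Prop) (N : ℕ) (h0 : I 0 s)
    (hstep : ∀ i s, i < N → I i s → b.Holds s ∧ Runs inp ω c s B (I (i + 1)))
    (hend : ∀ s, I N s → ¬ b.Holds s) : Runs inp ω (.loop b c) s (N * (B + 1) + 1) (I N) := by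
  have key : ∀ j i s, i + j = N → I i s →
      Runs inp ω (.loop b c) s (j * (B + 1) + 1) (I N) := by
    intro j
    induction j with
    | zero =>
      rintro i s rfl h
      exact ⟨1, s, .loopFalse (hend s h), by omega, h⟩
    | succ j ih =>
      intro i s hij h
      obtain ⟨hb, m, s', e, l, p⟩ := hstep i s (by omega) h
      obtain ⟨m', s'', e', l', p'⟩ := ih (i + 1) s' (by omega) p
      exact ⟨_, _, .loopTrue hb e e', by rw [add_mul]; omega, p'⟩
  exact key N 0 s (by omega) h0

end Hoare

/-- The uniform element of `{0, …, M - 1}` drawn from cell `q` of the tape. -/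
noncomputable def draw (ω : Tape) (q M : ℕ) : ℕ := min ⌊(ω q : ℝ) * (M : ℝ)⌋₊ (M - 1)

/-! ### Projections of updated states -/

namespace Instr

variable (inp : Input) (ω : Tape) (s : State) (a b c k : ℕ) (r : ℚ)

-- Each instruction gets one simp lemma describing all projections of the new state pointwise. With
-- these, `simp` evaluates a straight-line program variable by variable without ever unfolding a
-- whole state.
@[simp] theorem exec_natConst :
    (∀ v, (exec inp ω s (.natConst a k)).natVar v = (if v = a then k else s.natVar v)) ∧
    (∀ v, (exec inp ω s (.natConst a k)).realVar v = s.realVar v) ∧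
    (exec inp ω s (.natConst a k)).out = s.out ∧ (exec inp ω s (.natConst a k)).used = s.used :=
  ⟨Function.update_apply _ _ _, fun _ => rfl, rfl, rfl⟩

@[simp] theorem exec_natAdd :
    (∀ v, (exec inp ω s (.natAdd a b c)).natVar v = (if v = a then s.natVar b + s.natVar c else s.natVar v)) ∧
    (∀ v, (exec inp ω s (.natAdd a b c)).realVar v = s.realVar v) ∧
    (exec inp ω s (.natAdd a b c)).out = s.out ∧ (exec inp ω s (.natAdd a b c)).used = s.used :=
  ⟨Function.update_apply _ _ _, fun _ => rfl, rfl, rfl⟩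

@[simp] theorem exec_natRand :
    (∀ v, (exec inp ω s (.natRand a b)).natVar v = (if v = a then draw ω s.used (s.natVar b) else s.natVar v)) ∧
    (∀ v, (exec inp ω s (.natRand a b)).realVar v = s.realVar v) ∧
    (exec inp ω s (.natRand a b)).out = s.out ∧ (exec inp ω s (.natRand a b)).used = s.used + 1 :=
  ⟨Function.update_apply _ _ _, fun _ => rfl, rfl, rfl⟩

@[simp] theorem exec_realConst :
    (∀ v, (exec inp ω s (.realConst a r)).realVar v = (if v = a then (r : ℝ) else s.realVar v)) ∧
    (∀ v, (exec inp ω s (.realConst a r)).natVar v = s.natVar v) ∧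
    (exec inp ω s (.realConst a r)).out = s.out ∧ (exec inp ω s (.realConst a r)).used = s.used :=
  ⟨Function.update_apply _ _ _, fun _ => rfl, rfl, rfl⟩

@[simp] theorem exec_realOfNat :
    (∀ v, (exec inp ω s (.realOfNat a b)).realVar v = (if v = a then (s.natVar b : ℝ) else s.realVar v)) ∧
    (∀ v, (exec inp ω s (.realOfNat a b)).natVar v = s.natVar v) ∧
    (exec inp ω s (.realOfNat a b)).out = s.out ∧ (exec inp ω s (.realOfNat a b)).used = s.used :=
  ⟨Function.update_apply _ _ _, fun _ => rfl, rfl, rfl⟩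

@[simp] theorem exec_realAdd :
    (∀ v, (exec inp ω s (.realAdd a b c)).realVar v = (if v = a then s.realVar b + s.realVar c else s.realVar v)) ∧
    (∀ v, (exec inp ω s (.realAdd a b c)).natVar v = s.natVar v) ∧
    (exec inp ω s (.realAdd a b c)).out = s.out ∧ (exec inp ω s (.realAdd a b c)).used = s.used :=
  ⟨Function.update_apply _ _ _, fun _ => rfl, rfl, rfl⟩

@[simp] theorem exec_realSub :
    (∀ v, (exec inp ω s (.realSub a b c)).realVar v = (if v = a then s.realVar b - s.realVar c else s.realVar v)) ∧
    (∀ v, (exec inp ω s (.realSub a b c)).natVar v = s.natVar v) ∧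
    (exec inp ω s (.realSub a b c)).out = s.out ∧ (exec inp ω s (.realSub a b c)).used = s.used :=
  ⟨Function.update_apply _ _ _, fun _ => rfl, rfl, rfl⟩

@[simp] theorem exec_realMul :
    (∀ v, (exec inp ω s (.realMul a b c)).realVar v = (if v = a then s.realVar b * s.realVar c else s.realVar v)) ∧
    (∀ v, (exec inp ω s (.realMul a b c)).natVar v = s.natVar v) ∧
    (exec inp ω s (.realMul a b c)).out = s.out ∧ (exec inp ω s (.realMul a b c)).used = s.used :=
  ⟨Function.update_apply _ _ _, fun _ => rfl, rfl, rfl⟩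

@[simp] theorem exec_realDiv :
    (∀ v, (exec inp ω s (.realDiv a b c)).realVar v = (if v = a then s.realVar b / s.realVar c else s.realVar v)) ∧
    (∀ v, (exec inp ω s (.realDiv a b c)).natVar v = s.natVar v) ∧
    (exec inp ω s (.realDiv a b c)).out = s.out ∧ (exec inp ω s (.realDiv a b c)).used = s.used :=
  ⟨Function.update_apply _ _ _, fun _ => rfl, rfl, rfl⟩

@[simp] theorem exec_read :
    (∀ v, (exec inp ω s (.read a k b c)).realVar v = (if v = a then inp.table k (s.natVar b) (s.natVar c) else s.realVar v)) ∧
    (∀ v, (exec inp ω s (.read a k b c)).natVar v = s.natVar v) ∧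
    (exec inp ω s (.read a k b c)).out = s.out ∧ (exec inp ω s (.read a k b c)).used = s.used :=
  ⟨Function.update_apply _ _ _, fun _ => rfl, rfl, rfl⟩

@[simp] theorem exec_write :
    (∀ v, (exec inp ω s (.write a b)).realVar v = s.realVar v) ∧
    (∀ v, (exec inp ω s (.write a b)).natVar v = s.natVar v) ∧
    (exec inp ω s (.write a b)).out = Function.update s.out (s.natVar a) (s.realVar b) ∧
    (exec inp ω s (.write a b)).used = s.used :=
  ⟨fun _ => rfl, fun _ => rfl, rfl, rfl⟩

end Instr

/-! ### The common parameters -/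

/-- The threshold below which an entry of the data set is dropped. -/
noncomputable def cutoff (α β : ℝ) : ℝ := α * β * (α * β) * (1 / 4)

/-- The eighth power is one factor 1/x for the target error and seven for the mean of 8^s on an
entry that is kept. The least such k is what a program finds by doubling: `degree_spec` is the exit
condition of that loop and `lt_of_lt_degree` its guard. -/
theorem exists_degree (x : ℝ) : ∃ k : ℕ, (1 / x) ^ 8 ≤ 2 ^ k :=
  (pow_unbounded_of_one_lt _ one_lt_two).imp fun _ h => h.le

open Classical in
/-- The degree of the approximating polynomial, for the threshold `x`. -/
noncomputable def degree (x : ℝ) : ℕ := Nat.find (exists_degree x)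

theorem degree_spec (x : ℝ) : (1 / x) ^ 8 ≤ 2 ^ degree x := by
  classical exact Nat.find_spec (exists_degree x)

theorem lt_of_lt_degree {x : ℝ} {i : ℕ} (h : i < degree x) : (2 : ℝ) ^ i < (1 / x) ^ 8 := by
  classical exact not_le.1 (Nat.find_min (exists_degree x) h)

/-- The sample size before rounding, for the threshold `x`. -/
noncomputable def sampleBound (d : ℕ) (x : ℝ) : ℝ :=
  4 / x * (((d : ℝ) + 1) * ((d : ℝ) + 1)) ^ degree x

/-- The variables that hold the parameters. -/
structure HasParams (d n : ℕ) (x ε : ℝ) (s : State) : Prop where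
  n0 : s.natVar 0 = d
  n1 : s.natVar 1 = n
  n2 : s.natVar 2 = degree x
  n3 : s.natVar 3 = 1
  n4 : s.natVar 4 = d + 1
  n5 : s.natVar 5 = 0
  r2 : s.realVar 2 = ε
  r3 : s.realVar 3 = 1
  r4 : s.realVar 4 = sampleBound d x
  r5 : s.realVar 5 = d + 1
  r6 : s.realVar 6 = x

/-- Computation of the parameters. -/
def setupProg : Prog :=
  .seq (straight (.natConst 3 1) [.natConst 5 0, .natAdd 4 0 3, .realConst 3 1, .realOfNat 5 4,
      .realMul 6 0 1, .realMul 6 6 6, .realConst 8 (1 / 4), .realMul 6 6 8, .realDiv 9 3 6,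
      .realMul 9 9 9, .realMul 9 9 9, .realMul 9 9 9, .realConst 8 4, .realDiv 4 8 6,
      .realMul 10 5 5, .realConst 11 1, .realConst 12 2, .natConst 2 0])
    (.loop (.realLT 11 9)
      (straight (.realMul 11 11 12) [.natAdd 2 2 3, .realMul 4 4 10]))

theorem runs_setup {inp : Input} {ω : Tape} {d n : ℕ} {α β ε : ℝ}
    (h0 : inp.natInit 0 = d) (h1 : inp.natInit 1 = n) (h2 : inp.realInit 0 = α)
    (h3 : inp.realInit 1 = β) (h4 : inp.realInit 2 = ε) :
    Runs inp ω setupProg inp.start (19 + (degree (cutoff α β) * 4 + 1)) fun s =>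
      HasParams d n (cutoff α β) ε s ∧ s.used = 0 ∧ s.out = 0 := by
  set x := cutoff α β with hx
  refine Runs.seq (Mid := fun s => s.natVar 0 = d ∧ s.natVar 1 = n ∧ s.natVar 2 = 0 ∧
    s.natVar 3 = 1 ∧ s.natVar 4 = d + 1 ∧ s.natVar 5 = 0 ∧ s.realVar 2 = ε ∧ s.realVar 3 = 1 ∧
    s.realVar 4 = 4 / x ∧ s.realVar 5 = d + 1 ∧ s.realVar 6 = x ∧ s.realVar 9 = (1 / x) ^ 8 ∧
    s.realVar 10 = ((d : ℝ) + 1) * ((d : ℝ) + 1) ∧ s.realVar 11 = 1 ∧ s.realVar 12 = 2 ∧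
    s.used = 0 ∧ s.out = 0) ?_ ?_
  · refine Runs.straight (by simp) ?_
    simp [Input.start, h0, h1, h2, h3, h4, hx, cutoff]
    exact ⟨by ring, rfl⟩
  · rintro s ⟨a0, a1, a2, a3, a4, a5, b2, b3, b4, b5, b6, b9, b10, b11, b12, hu, ho⟩
    -- Variable 11 runs through the powers of two until it reaches (1/x)^8, held in variable 9,
    -- while variable 4 collects a factor (d+1)² per round. No logarithm or power is needed.
    refine (Runs.loop (B := 3) (fun i s => s.natVar 0 = d ∧ s.natVar 1 = n ∧ s.natVar 2 = i ∧
      s.natVar 3 = 1 ∧ s.natVar 4 = d + 1 ∧ s.natVar 5 = 0 ∧ s.realVar 2 = ε ∧ s.realVar 3 = 1 ∧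
      s.realVar 4 = 4 / x * (((d : ℝ) + 1) * ((d : ℝ) + 1)) ^ i ∧ s.realVar 5 = d + 1 ∧
      s.realVar 6 = x ∧ s.realVar 9 = (1 / x) ^ 8 ∧
      s.realVar 10 = ((d : ℝ) + 1) * ((d : ℝ) + 1) ∧ s.realVar 11 = 2 ^ i ∧ s.realVar 12 = 2 ∧
      s.used = 0 ∧ s.out = 0) (degree x) ?_ ?_ ?_).mono le_rfl ?_
    · simp [*]
    · rintro i s hi ⟨a0, a1, a2, a3, a4, a5, b2, b3, b4, b5, b6, b9, b10, b11, b12, hu, ho⟩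
      refine ⟨?_, Runs.straight (by simp) ?_⟩
      · simpa only [Test.Holds, b11, b9] using lt_of_lt_degree hi
      · simp [a0, a1, a2, a3, a4, a5, b2, b3, b4, b5, b6,
          b9, b10, b11, b12, hu, ho, pow_succ, mul_assoc]
    · rintro s ⟨a0, a1, a2, a3, a4, a5, b2, b3, b4, b5, b6, b9, b10, b11, b12, hu, ho⟩
      simpa only [Test.Holds, b11, b9, not_lt] using degree_spec x
    · rintro s ⟨a0, a1, a2, a3, a4, a5, b2, b3, b4, b5, b6, b9, b10, b11, b12, hu, ho⟩
      exact ⟨⟨a0, a1, a2, a3, a4, a5, b2, b3, b4, b5, b6⟩, hu, ho⟩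

/-! ### The release program -/

/-! ### The synopsis as an explicit function of the tape -/

section Spec

variable (d n k : ℕ) (x : ℝ) (p : ℕ → ℝ) (Z : ℕ → ℕ → ℝ) (ω : Tape)

/-- The probability that no attribute of row `i` is in a random query. -/
noncomputable def missProb (i : ℕ) : ℝ := ∏ j ∈ Finset.range d, (1 - Z i j * p j)

/-- The product of the attributes `τ 0, …, τ (k - 1)` in a row, where the attribute `d` is constantly
one. -/
noncomputable def tupleProd (z : ℕ → ℝ) (k : ℕ) (τ : ℕ → ℕ) : ℝ :=
  ∏ j ∈ Finset.range k, if τ j < d then z (τ j) else 1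

/-- The sampled bit before noise is added. -/
noncomputable def keptProd (i : ℕ) (τ : ℕ → ℕ) : ℝ :=
  (if missProb d p Z i < x then 0 else 1) * tupleProd d (Z i) k τ

/-- The noisy bit: rows `n, …, 2n - 1` stand for the bit one, and rows `2n, …, 3n - 1` for the bit
zero. -/
noncomputable def noisyBit (i : ℕ) (τ : ℕ → ℕ) : ℝ :=
  if i < n then keptProd d k x p Z i τ else if i < n + n then 1 else 0

/-- Contents of cell `q` of the output memory of the release program. -/
noncomputable def outCell (q : ℕ) : ℝ :=
  if q % (k + 1) < k then (draw ω (q + 1) (d + 1) : ℝ)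
  else 3 * noisyBit d n k x p Z (draw ω (q / (k + 1) * (k + 1)) (n + n + n))
    (fun j => draw ω (q / (k + 1) * (k + 1) + 1 + j) (d + 1)) - 1

/-- The output memory after `u` cells are written. -/
noncomputable def outPrefix (u q : ℕ) : ℝ := if q < u then outCell d n k x p Z ω q else 0

theorem update_outPrefix (u : ℕ) :
    Function.update (outPrefix d n k x p Z ω u) u (outCell d n k x p Z ω u) =
      outPrefix d n k x p Z ω (u + 1) := by
  ext q
  rcases lt_trichotomy q u with h | rfl | h
  · simp [outPrefix, h.ne, h, h.trans (Nat.lt_succ_self u)]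
  · simp [outPrefix]
  · simp [outPrefix, h.ne', h.not_gt, show ¬ q < u + 1 by omega]

theorem outPrefix_zero : outPrefix d n k x p Z ω 0 = 0 := by
  ext q; simp [outPrefix]

/-- A round consumes k + 1 tape cells and writes k + 1 output cells. The row is drawn first but the
bit is written last, so the tuple is shifted by one between tape and output. -/
theorem outCell_tuple {r j : ℕ} (hj : j < k) :
    outCell d n k x p Z ω (r * (k + 1) + j) = draw ω (r * (k + 1) + 1 + j) (d + 1) := by
  have : (r * (k + 1) + j) % (k + 1) = j := by
    rw [mul_comm, Nat.mul_add_mod, Nat.mod_eq_of_lt (by omega)]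
  rw [outCell, if_pos (by omega), add_right_comm]

theorem outCell_bit (r : ℕ) :
    outCell d n k x p Z ω (r * (k + 1) + k) =
      3 * noisyBit d n k x p Z (draw ω (r * (k + 1)) (n + n + n))
        (fun j => draw ω (r * (k + 1) + 1 + j) (d + 1)) - 1 := by
  have h1 : (r * (k + 1) + k) % (k + 1) = k := by
    rw [mul_comm, Nat.mul_add_mod, Nat.mod_eq_of_lt (by omega)]
  have h2 : (r * (k + 1) + k) / (k + 1) = r := by
    rw [mul_comm, Nat.mul_add_div (by omega), Nat.div_eq_of_lt (by omega), add_zero]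
  rw [outCell, if_neg (by omega), h2]

end Spec

/-- Draws the row, and decides if it is dropped. -/
def rowProg (a b : ℚ) : Prog :=
  .seq (straight (.natRand 7 6) [.natConst 8 0, .realConst 12 1, .realConst 14 b, .realConst 15 a])
  (.seq (.loop (.natLT 8 0) (straight (.read 11 0 7 8) [.realMul 11 14 11, .realAdd 11 15 11,
      .read 13 1 5 8, .realMul 11 11 13, .realSub 11 3 11, .realMul 12 12 11, .natAdd 8 8 3]))
    (.cond (.realLT 12 6) (straight (.realConst 10 0) [.natConst 8 0])
      (straight (.realConst 10 1) [.natConst 8 0])))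

/-- Draws and writes the tuple of attributes, and multiplies them. -/
def tupleProg : Prog :=
  .loop (.natLT 8 2) (.seq
    (straight (.natRand 9 4) [.realOfNat 11 9, .write 10 11, .natAdd 10 10 3, .natAdd 8 8 3])
    (.cond (.natLT 9 0)
      (straight (.read 11 0 7 9) [.realMul 11 14 11, .realAdd 11 15 11, .realMul 10 10 11])
      (.instr (.natConst 5 0))))

/-- Adds the noise to the bit, and writes it. -/
def noiseProg : Prog :=
  .seq (.cond (.natLT 7 1) (.instr (.natConst 5 0))
      (.cond (.natLT 7 12) (.instr (.realConst 10 1)) (.instr (.realConst 10 0))))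
    (straight (.realConst 11 3) [.realMul 11 11 10, .realSub 11 11 3, .write 10 11,
      .natAdd 10 10 3, .realAdd 9 9 3])

/-- The release program. -/
def releaseProg (a b : ℚ) : Prog :=
  .seq setupProg (.seq (straight (.natAdd 12 1 1) [.natAdd 6 12 1, .realOfNat 8 1, .realMul 8 8 2,
      .realAdd 11 4 3, .realConst 9 0, .natConst 10 0])
    (.cond (.realLT 11 8)
      (.loop (.realLT 9 4) (.seq (rowProg a b) (.seq tupleProg noiseProg)))
      (.instr (.natConst 5 0))))

/-! ### Correctness of the release program -/

section Release

variable {inp : Input} {ω : Tape} {d n r : ℕ} {x ε : ℝ} {a b : ℚ} {s : State}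

/-- The state during a round of the release program, after `u` cells of the output memory are
written. -/
structure InRound (inp : Input) (ω : Tape) (d n : ℕ) (x ε : ℝ) (a b : ℚ) (r u : ℕ) (s : State) :
    Prop extends HasParams d n x ε s where
  n6 : s.natVar 6 = n + n + n
  n10 : s.natVar 10 = u
  n12 : s.natVar 12 = n + n
  r9 : s.realVar 9 = r
  out : s.out = outPrefix d n (degree x) x (inp.table 1 0) (fun i j => a + b * inp.table 0 i j) ω u

/-- The state after the row is drawn. -/
structure RowDrawn (ω : Tape) (n : ℕ) (a b : ℚ) (k r : ℕ) (s : State) : Prop where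
  n7 : s.natVar 7 = draw ω (r * (k + 1)) (n + n + n)
  r14 : s.realVar 14 = b
  r15 : s.realVar 15 = a

/-- An index of n or more is processed here like a row of the table; what is computed from it is
discarded later, by the case distinction in `noisyBit`. -/
theorem runs_row
    (h : InRound inp ω d n x ε a b r (r * (degree x + 1)) s) (hu : s.used = r * (degree x + 1)) :
    Runs inp ω (rowProg a b) s (5 + (d * (8 + 1) + 1 + (1 + 2))) fun s =>
      InRound inp ω d n x ε a b r (r * (degree x + 1)) s ∧ RowDrawn ω n a b (degree x) r s ∧
      s.used = r * (degree x + 1) + 1 ∧ s.natVar 8 = 0 ∧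
      s.realVar 10 = if missProb d (inp.table 1 0) (fun i j => a + b * inp.table 0 i j)
        (s.natVar 7) < x then 0 else 1 := by
  refine Runs.seq (Mid := fun s => InRound inp ω d n x ε a b r (r * (degree x + 1)) s ∧
    RowDrawn ω n a b (degree x) r s ∧ s.used = r * (degree x + 1) + 1 ∧ s.natVar 8 = 0 ∧
    s.realVar 12 = 1) ?_ ?_
  · refine Runs.straight (by simp) ⟨⟨⟨?_, ?_, ?_, ?_, ?_, ?_, ?_, ?_, ?_, ?_, ?_⟩,
      ?_, ?_, ?_, ?_, ?_⟩, ⟨?_, ?_, ?_⟩, ?_, ?_, ?_⟩ <;>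
    simp [h.n0, h.n1, h.n2, h.n3, h.n4, h.n5, h.n6, h.n10,
      h.n12, h.r2, h.r3, h.r4, h.r5, h.r6, h.r9, h.out, hu]
  · rintro s ⟨h, hr, hu, h8, h12⟩
    refine Runs.seq (Runs.loop (B := 8) (fun i s =>
      InRound inp ω d n x ε a b r (r * (degree x + 1)) s ∧
      RowDrawn ω n a b (degree x) r s ∧ s.used = r * (degree x + 1) + 1 ∧ s.natVar 8 = i ∧
      s.realVar 12 = missProb i (inp.table 1 0) (fun i j => a + b * inp.table 0 i j)
        (s.natVar 7)) d ?_ ?_ ?_) ?_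
    · exact ⟨h, hr, hu, h8, by simp [h12, missProb]⟩
    · rintro i s hi ⟨h, hr, hu, h8, h12⟩
      refine ⟨by simpa [Test.Holds, h8, h.n0] using hi, Runs.straight (by simp)
        ⟨⟨⟨?_, ?_, ?_, ?_, ?_, ?_, ?_, ?_, ?_, ?_, ?_⟩, ?_, ?_, ?_, ?_, ?_⟩,
        ⟨?_, ?_, ?_⟩, ?_, ?_, ?_⟩⟩ <;>
      simp [h.n0, h.n1, h.n2, h.n3, h.n4, h.n5, h.n6,
        h.n10, h.n12, h.r2, h.r3, h.r4, h.r5, h.r6, h.r9, h.out, hu, hr.n7, hr.r14, hr.r15, h8, h12,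
        missProb, Finset.prod_range_succ]
    · rintro s ⟨h, hr, hu, h8, h12⟩
      simp [Test.Holds, h8, h.n0]
    · rintro s ⟨h, hr, hu, h8, h12⟩
      refine Runs.cond (fun hc => ?_) (fun hc => ?_) <;> rw [Test.Holds, h12, h.r6] at hc <;>
      refine Runs.straight (by simp) ⟨⟨⟨?_, ?_, ?_, ?_, ?_, ?_, ?_, ?_, ?_, ?_, ?_⟩,
        ?_, ?_, ?_, ?_, ?_⟩, ⟨?_, ?_, ?_⟩, ?_, ?_, ?_⟩ <;>
      simp [h.n0, h.n1, h.n2, h.n3, h.n4, h.n5, h.n6,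
        h.n10, h.n12, h.r2, h.r3, h.r4, h.r5, h.r6, h.r9, h.out, hu, hr.n7, hr.r14, hr.r15] <;>
      simpa [hr.n7] using hc

theorem runs_tuple {c : ℝ}
    (h : InRound inp ω d n x ε a b r (r * (degree x + 1)) s) (hr : RowDrawn ω n a b (degree x) r s)
    (hu : s.used = r * (degree x + 1) + 1) (h8 : s.natVar 8 = 0) (h10 : s.realVar 10 = c) :
    Runs inp ω tupleProg s (degree x * (5 + (1 + 4) + 1) + 1) fun s =>
      InRound inp ω d n x ε a b r (r * (degree x + 1) + degree x) s ∧
      RowDrawn ω n a b (degree x) r s ∧ s.used = (r + 1) * (degree x + 1) ∧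
      s.realVar 10 = c * tupleProd d (fun j => a + b * inp.table 0 (s.natVar 7) j) (degree x)
        (fun j => draw ω (r * (degree x + 1) + 1 + j) (d + 1)) := by
  refine (Runs.loop (fun j s => InRound inp ω d n x ε a b r (r * (degree x + 1) + j) s ∧
      RowDrawn ω n a b (degree x) r s ∧ s.used = r * (degree x + 1) + 1 + j ∧ s.natVar 8 = j ∧
      s.realVar 10 = c * tupleProd d (fun j => a + b * inp.table 0 (s.natVar 7) j) j
        (fun j => draw ω (r * (degree x + 1) + 1 + j) (d + 1))) (degree x) ?_ ?_ ?_).mono le_rfl ?_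
  · exact ⟨h, hr, hu, h8, by simp [h10, tupleProd]⟩
  · rintro j s hj ⟨h, hr, hu, h8, h10⟩
    refine ⟨by simpa [Test.Holds, h8, h.n2] using hj, ?_⟩
    refine Runs.seq (Mid := fun s => InRound inp ω d n x ε a b r (r * (degree x + 1) + (j + 1)) s ∧
      RowDrawn ω n a b (degree x) r s ∧ s.used = r * (degree x + 1) + 1 + (j + 1) ∧
      s.natVar 8 = j + 1 ∧ s.natVar 9 = draw ω (r * (degree x + 1) + 1 + j) (d + 1) ∧
      s.realVar 10 = c * tupleProd d (fun j => a + b * inp.table 0 (s.natVar 7) j) j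
        (fun j => draw ω (r * (degree x + 1) + 1 + j) (d + 1))) ?_ ?_
    · have hcell := update_outPrefix d n (degree x) x (inp.table 1 0)
        (fun i j => a + b * inp.table 0 i j) ω (r * (degree x + 1) + j)
      rw [outCell_tuple _ _ _ _ _ _ _ hj] at hcell
      refine Runs.straight (by simp) ⟨⟨⟨?_, ?_, ?_, ?_, ?_, ?_, ?_, ?_, ?_, ?_, ?_⟩,
        ?_, ?_, ?_, ?_, ?_⟩, ⟨?_, ?_, ?_⟩, ?_, ?_, ?_, ?_⟩ <;>
      simp [h.n0, h.n1, h.n2, h.n3, h.n4, h.n5, h.n6,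
        h.n10, h.n12, h.r2, h.r3, h.r4, h.r5, h.r6, h.r9, h.out, hu, hr.n7, hr.r14, hr.r15, h8,
        h10, add_assoc]
      · simpa [add_assoc] using hcell
    · rintro s ⟨h, hr, hu, h8, h9, h10⟩
      refine Runs.cond (B := 4) (fun hc => ?_) (fun hc => ?_) <;>
      rw [Test.Holds, h9, h.n0] at hc
      · refine Runs.straight (by simp) ⟨⟨⟨?_, ?_, ?_, ?_, ?_, ?_, ?_, ?_, ?_, ?_, ?_⟩,
          ?_, ?_, ?_, ?_, ?_⟩, ⟨?_, ?_, ?_⟩, ?_, ?_, ?_⟩ <;>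
        simp [h.n0, h.n1, h.n2, h.n3, h.n4, h.n5, h.n6,
          h.n10, h.n12, h.r2, h.r3, h.r4, h.r5, h.r6, h.r9, h.out, hu, hr.n7, hr.r14, hr.r15, h8,
          h9, h10, tupleProd, Finset.prod_range_succ, hc, mul_assoc]
      -- Attribute d stands for the constant one, so nothing is multiplied. Storing 0 in variable 5,
      -- which always holds 0, acts as an empty instruction.
      · refine Runs.straight (i := _) (l := []) (by simp) ⟨⟨⟨?_, ?_, ?_, ?_, ?_, ?_, ?_, ?_, ?_, ?_,
          ?_⟩, ?_, ?_, ?_, ?_, ?_⟩, ⟨?_, ?_, ?_⟩, ?_, ?_, ?_⟩ <;>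
        simp [h.n0, h.n1, h.n2, h.n3, h.n4, h.n5, h.n6,
          h.n10, h.n12, h.r2, h.r3, h.r4, h.r5, h.r6, h.r9, h.out, hu, hr.n7, hr.r14, hr.r15, h8,
          h9, h10, tupleProd, Finset.prod_range_succ, hc]
  · rintro s ⟨h, hr, hu, h8, h10⟩
    simp [Test.Holds, h8, h.n2]
  · rintro s ⟨h, hr, hu, h8, h10⟩
    exact ⟨h, hr, by rw [hu]; ring, h10⟩

theorem runs_noise
    (h : InRound inp ω d n x ε a b r (r * (degree x + 1) + degree x) s)
    (hr : RowDrawn ω n a b (degree x) r s) (hu : s.used = (r + 1) * (degree x + 1))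
    (h10 : s.realVar 10 = keptProd d (degree x) x (inp.table 1 0)
      (fun i j => a + b * inp.table 0 i j) (s.natVar 7)
      (fun j => draw ω (r * (degree x + 1) + 1 + j) (d + 1))) :
    Runs inp ω noiseProg s ((1 + (1 + 1)) + 6) fun s =>
      InRound inp ω d n x ε a b (r + 1) ((r + 1) * (degree x + 1)) s ∧
      s.used = (r + 1) * (degree x + 1) := by
  refine Runs.seq (Mid := fun s => InRound inp ω d n x ε a b r (r * (degree x + 1) + degree x) s ∧
    s.used = (r + 1) * (degree x + 1) ∧
    s.realVar 10 = noisyBit d n (degree x) x (inp.table 1 0)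
      (fun i j => a + b * inp.table 0 i j) (draw ω (r * (degree x + 1)) (n + n + n))
      (fun j => draw ω (r * (degree x + 1) + 1 + j) (d + 1))) ?_ ?_
  · rw [hr.n7] at h10
    refine Runs.cond (fun hc => ?_) (fun hc => Runs.cond (fun hc' => ?_) (fun hc' => ?_)) <;>
    rw [Test.Holds, hr.n7, h.n1] at hc <;> try rw [Test.Holds, hr.n7, h.n12] at hc'
    all_goals
      refine Runs.straight (i := _) (l := []) (by simp) ⟨⟨⟨?_, ?_, ?_, ?_, ?_, ?_, ?_, ?_, ?_, ?_,
        ?_⟩, ?_, ?_, ?_, ?_, ?_⟩, ?_, ?_⟩ <;>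
      simp [h.n0, h.n1, h.n2, h.n3, h.n4, h.n5, h.n6,
        h.n10, h.n12, h.r2, h.r3, h.r4, h.r5, h.r6, h.r9, h.out, hu, h10, noisyBit, hc, *]
  · rintro s ⟨h, hu, h10⟩
    have hcell := update_outPrefix d n (degree x) x (inp.table 1 0)
      (fun i j => a + b * inp.table 0 i j) ω (r * (degree x + 1) + degree x)
    rw [outCell_bit] at hcell
    have e : (r + 1) * (degree x + 1) = r * (degree x + 1) + degree x + 1 := by ring
    refine Runs.straight (by simp) ⟨⟨⟨?_, ?_, ?_, ?_, ?_, ?_, ?_, ?_, ?_, ?_, ?_⟩,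
        ?_, ?_, ?_, ?_, ?_⟩, ?_⟩ <;>
    simp [h.n0, h.n1, h.n2, h.n3, h.n4, h.n5, h.n6,
      h.n10, h.n12, h.r2, h.r3, h.r4, h.r5, h.r6, h.r9, h.out, hu, h10]
    · rw [e]
    · rw [e, ← hcell]

/-- A bound on the number of steps of the release program, for `m` rounds. -/
def releaseTime (d k m : ℕ) : ℕ := 50 + 50 * (m + 1) * (k + 1) * (d + 1)

/-- The output of the release program. -/
noncomputable def releaseOut (d n : ℕ) (x ε : ℝ) (a b : ℚ) (inp : Input) (ω : Tape) : ℕ → ℝ :=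
  if sampleBound d x + 1 < n * ε then
    outPrefix d n (degree x) x (inp.table 1 0) (fun i j => a + b * inp.table 0 i j) ω
      (⌈sampleBound d x⌉₊ * (degree x + 1))
  else 0

theorem runs_release {α β : ℝ} (h0 : inp.natInit 0 = d) (h1 : inp.natInit 1 = n)
    (h2 : inp.realInit 0 = α) (h3 : inp.realInit 1 = β) (h4 : inp.realInit 2 = ε)
    (hx : cutoff α β = x) :
    Runs inp ω (releaseProg a b) inp.start (releaseTime d (degree x) ⌈sampleBound d x⌉₊)
      fun s => s.out = releaseOut d n x ε a b inp ω := by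
  have hs := runs_setup (ω := ω) h0 h1 h2 h3 h4
  rw [hx] at hs
  set m := ⌈sampleBound d x⌉₊ with hm
  refine (Runs.seq hs (B₂ := 7 + (1 + (m * ((5 + (d * (8 + 1) + 1 +
    (1 + 2))) + ((degree x * (5 + (1 + 4) + 1) + 1) + ((1 + (1 + 1)) + 6)) + 1) + 1))) ?_).mono ?_
    fun s hs => hs
  · rintro s ⟨h, hu, ho⟩
    refine Runs.seq (Mid := fun s => InRound inp ω d n x ε a b 0 0 s ∧ s.used = 0 ∧
      s.realVar 11 = sampleBound d x + 1 ∧ s.realVar 8 = n * ε) ?_ ?_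
    · refine Runs.straight (by simp) ⟨⟨⟨?_, ?_, ?_, ?_, ?_, ?_, ?_, ?_, ?_, ?_, ?_⟩,
        ?_, ?_, ?_, ?_, ?_⟩, ?_, ?_, ?_⟩ <;>
      simp [h.n0, h.n1, h.n2, h.n3, h.n4, h.n5,
        h.r2, h.r3, h.r4, h.r5, h.r6, hu, ho, outPrefix_zero]
    · rintro s ⟨h, hu, h11, h8⟩
      refine Runs.cond (fun hc => ?_) (fun hc => ?_) <;> rw [Test.Holds, h11, h8] at hc
      · refine (Runs.loop (fun r s => InRound inp ω d n x ε a b r (r * (degree x + 1)) s ∧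
          s.used = r * (degree x + 1)) m ?_ ?_ ?_).mono le_rfl ?_
        · simp only [zero_mul]
          exact ⟨h, hu⟩
        · rintro r s hr ⟨h, hu⟩
          refine ⟨?_, ?_⟩
          · rw [Test.Holds, h.r9, h.r4]
            -- Comparing the real round counter with the unrounded bound yields exactly
            -- ⌈sampleBound⌉ rounds, without computing a ceiling.
            exact Nat.lt_ceil.1 hr
          · refine Runs.seq (runs_row h hu) ?_
            rintro s ⟨h, hr, hu, h8, h10⟩
            refine Runs.seq (runs_tuple h hr hu h8 h10) ?_
            rintro s' ⟨h', hr', hu', h10'⟩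
            refine runs_noise h' hr' hu' ?_
            rw [h10', keptProd, hr.n7, hr'.n7]
        · rintro s ⟨h, hu⟩
          rw [Test.Holds, h.r9, h.r4, not_lt]
          exact Nat.le_ceil _
        · rintro s ⟨h, hu⟩
          rw [h.out, releaseOut, if_pos hc]
      · refine Runs.straight (i := _) (l := []) (by simp) ?_
        simp [h.out, outPrefix_zero, releaseOut, if_neg hc]
  · rw [releaseTime]
    -- The step count is a polynomial in m, k and d; these are the monomials that `nlinarith` needs
    -- for comparing it with the product bound.
    have e1 : 0 ≤ m * (degree x * d) := by positivity
    have e2 : 0 ≤ degree x * d := by positivity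
    have e3 : 0 ≤ m * d := by positivity
    have e4 : 0 ≤ m * degree x := by positivity
    nlinarith

end Release

/-! ### The answering program -/

/-- The factor that attribute `t` in position `j` of a tuple contributes to the answer to the query
`σ`. -/
noncomputable def factor (d : ℕ) (σ : ℕ → ℝ) (j t : ℕ) : ℝ :=
  if t < d then 0 - σ t * (d + 1) / (j + 1) else d + 1

/-- The factor of a tuple. -/
noncomputable def tupleFactor (d k : ℕ) (σ : ℕ → ℝ) (τ : ℕ → ℕ) : ℝ :=
  ∏ j ∈ Finset.range k, factor d σ j (τ j)

/-- The estimate from `m` records, each a tuple `τ r` and a number `v r`. -/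
noncomputable def estimate (d k : ℕ) (σ : ℕ → ℝ) (τ : ℕ → ℕ → ℕ) (v : ℕ → ℝ) (m : ℕ) : ℝ :=
  (∑ r ∈ Finset.range m, tupleFactor d k σ (τ r) * v r) / m

/-- Reads a tuple and multiplies the factors. -/
def readTupleProg : Prog :=
  .loop (.natLT 8 2) (.seq
    (straight (.read 11 2 5 10) [.natAdd 10 10 3, .natConst 7 0, .realConst 13 0, .realAdd 12 12 3,
      .natAdd 8 8 3])
    (.seq (.loop (.realLT 13 11) (straight (.natAdd 7 7 3) [.realAdd 13 13 3]))
      (.cond (.natLT 7 0)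
        (straight (.read 14 0 5 7) [.realMul 14 14 5, .realDiv 14 14 12, .realSub 14 21 14,
          .realMul 10 10 14])
        (straight (.realMul 10 10 5) []))))

/-- The answering program. -/
def answerProg (a b : ℚ) : Prog :=
  .seq setupProg (.seq
    (straight (.natConst 10 0) [.realConst 9 0, .realConst 20 0, .realConst 21 0])
    (.seq
      (.loop (.realLT 9 4) (.seq
        (straight (.natConst 8 0) [.realConst 10 1, .realConst 12 0])
        (.seq readTupleProg
          (straight (.read 11 2 5 10) [.natAdd 10 10 3, .realMul 10 10 11, .realAdd 20 20 10,
            .realAdd 9 9 3]))))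
      (straight (.realDiv 20 20 9) [.realConst 10 a, .realConst 11 b, .realMul 20 20 11,
        .realAdd 20 20 10, .write 5 20])))

/-! ### Correctness of the answering program -/

section Answer

variable {inp : Input} {ω : Tape} {d r : ℕ} {x ε : ℝ} {a b : ℚ} {s : State} {τ : ℕ → ℕ → ℕ}
  {v : ℕ → ℝ}

/-- The state during a round of the answering program, with the pointer to the synopsis at `u`. -/
structure InAnswer (inp : Input) (d : ℕ) (x ε : ℝ) (τ : ℕ → ℕ → ℕ) (v : ℕ → ℝ) (r u : ℕ)
    (s : State) : Prop extends HasParams d 0 x ε s where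
  n10 : s.natVar 10 = u
  r9 : s.realVar 9 = r
  r20 : s.realVar 20 = ∑ r ∈ Finset.range r, tupleFactor d (degree x) (inp.table 0 0) (τ r) * v r
  r21 : s.realVar 21 = 0

theorem runs_readTuple (h : InAnswer inp d x ε τ v r (r * (degree x + 1)) s) (h8 : s.natVar 8 = 0)
    (h10 : s.realVar 10 = 1) (h12 : s.realVar 12 = 0)
    (hτ : ∀ j < degree x, inp.table 2 0 (r * (degree x + 1) + j) = τ r j ∧ τ r j ≤ d) :
    Runs inp ω readTupleProg s (degree x * (6 + (d * (2 + 1) + 1 + (1 + 5)) + 1) + 1) fun s =>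
      InAnswer inp d x ε τ v r (r * (degree x + 1) + degree x) s ∧
      s.realVar 10 = tupleFactor d (degree x) (inp.table 0 0) (τ r) := by
  refine (Runs.loop (fun j s => InAnswer inp d x ε τ v r (r * (degree x + 1) + j) s ∧
    s.natVar 8 = j ∧ s.realVar 12 = j ∧ s.realVar 10 = tupleFactor d j (inp.table 0 0) (τ r))
    (degree x) ?_ ?_ ?_).mono le_rfl ?_
  · exact ⟨h, h8, by simp [h12], by simp [h10, tupleFactor]⟩
  · rintro j s hj ⟨h, h8, h12, h10⟩
    obtain ⟨hy, hd⟩ := hτ j hj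
    refine ⟨by simpa [Test.Holds, h8, h.n2] using hj, ?_⟩
    refine Runs.seq (Mid := fun s => InAnswer inp d x ε τ v r (r * (degree x + 1) + (j + 1)) s ∧
      s.natVar 8 = j + 1 ∧ s.realVar 12 = j + 1 ∧
      s.realVar 10 = tupleFactor d j (inp.table 0 0) (τ r) ∧
      s.realVar 11 = τ r j ∧ s.natVar 7 = 0 ∧ s.realVar 13 = 0) ?_ ?_
    · refine Runs.straight (by simp) ⟨⟨⟨?_, ?_, ?_, ?_, ?_, ?_, ?_, ?_, ?_, ?_, ?_⟩,
        ?_, ?_, ?_, ?_⟩, ?_, ?_, ?_, ?_, ?_, ?_⟩ <;>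
      simp [h.n0, h.n1, h.n2, h.n3, h.n4, h.n5, h.n10, h.r2, h.r3, h.r4, h.r5, h.r6, h.r9, h.r20,
        h.r21, h8, h10, h12, hy, add_assoc]
    · rintro s ⟨h, h8, h12, h10, h11, h7, h13⟩
      -- No instruction turns a real into a natural number, so the attribute is recovered by
      -- counting up to it. The bound τ r j ≤ d limits this to d rounds.
      refine (Runs.seq (Runs.loop (B := 2) (fun i s =>
        InAnswer inp d x ε τ v r (r * (degree x + 1) + (j + 1)) s ∧
        s.natVar 8 = j + 1 ∧ s.realVar 12 = j + 1 ∧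
        s.realVar 10 = tupleFactor d j (inp.table 0 0) (τ r) ∧
        s.realVar 11 = τ r j ∧ s.natVar 7 = i ∧ s.realVar 13 = i) (τ r j) ?_ ?_ ?_)
        (B₂ := 1 + 5) ?_).mono (by gcongr) fun s hs => hs
      · exact ⟨h, h8, h12, h10, h11, h7, by simp [h13]⟩
      · rintro i s hi ⟨h, h8, h12, h10, h11, h7, h13⟩
        refine ⟨by simpa [Test.Holds, h13, h11] using hi, ?_⟩
        refine Runs.straight (by simp) ⟨⟨⟨?_, ?_, ?_, ?_, ?_, ?_, ?_, ?_, ?_, ?_, ?_⟩,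
          ?_, ?_, ?_, ?_⟩, ?_, ?_, ?_, ?_, ?_, ?_⟩ <;>
        simp [h.n0, h.n1, h.n2, h.n3, h.n4, h.n5, h.n10, h.r2, h.r3, h.r4, h.r5, h.r6, h.r9, h.r20,
          h.r21, h8, h10, h12, h11, h7, h13]
      · rintro s ⟨h, h8, h12, h10, h11, h7, h13⟩
        simp [Test.Holds, h13, h11]
      · rintro s ⟨h, h8, h12, h10, h11, h7, h13⟩
        refine Runs.cond (fun hc => ?_) (fun hc => ?_) <;> rw [Test.Holds, h7, h.n0] at hc <;>
        refine Runs.straight (by simp) ⟨⟨⟨?_, ?_, ?_, ?_, ?_, ?_, ?_, ?_, ?_, ?_, ?_⟩,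
          ?_, ?_, ?_, ?_⟩, ?_, ?_, ?_⟩ <;>
        simp [h.n0, h.n1, h.n2, h.n3, h.n4, h.n5, h.n10, h.r2, h.r3, h.r4, h.r5, h.r6, h.r9, h.r20,
          h.r21, h8, h10, h12, h11, h7, h13, tupleFactor, Finset.prod_range_succ, factor, hc]
  · rintro s ⟨h, h8, h12, h10⟩
    simp [Test.Holds, h8, h.n2]
  · rintro s ⟨h, h8, h12, h10⟩
    exact ⟨h, h10⟩

theorem runs_answer {α β : ℝ} (h0 : inp.natInit 0 = d) (h1 : inp.natInit 1 = 0)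
    (h2 : inp.realInit 0 = α) (h3 : inp.realInit 1 = β) (h4 : inp.realInit 2 = ε)
    (hx : cutoff α β = x)
    (hτ : ∀ r < ⌈sampleBound d x⌉₊, ∀ j < degree x,
      inp.table 2 0 (r * (degree x + 1) + j) = τ r j ∧ τ r j ≤ d)
    (hv : ∀ r < ⌈sampleBound d x⌉₊, inp.table 2 0 (r * (degree x + 1) + degree x) = v r) :
    Runs inp ω (answerProg a b) inp.start (releaseTime d (degree x) ⌈sampleBound d x⌉₊)
      fun s => s.out 0 =
        a + b * estimate d (degree x) (inp.table 0 0) τ v ⌈sampleBound d x⌉₊ := by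
  have hs := runs_setup (ω := ω) h0 h1 h2 h3 h4
  rw [hx] at hs
  set m := ⌈sampleBound d x⌉₊ with hm
  refine (Runs.seq hs (B₂ := 4 + ((m * ((3 + ((degree x * (6 + (d * (2 + 1) + 1 + (1 + 5)) + 1) + 1)
    + 5)) + 1) + 1) + 6)) ?_).mono ?_ fun s hs => hs
  · rintro s ⟨h, hu, ho⟩
    refine Runs.seq (Mid := InAnswer inp d x ε τ v 0 0) ?_ ?_
    · refine Runs.straight (by simp) ⟨⟨?_, ?_, ?_, ?_, ?_, ?_, ?_, ?_, ?_, ?_, ?_⟩,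
        ?_, ?_, ?_, ?_⟩ <;>
      simp [h.n0, h.n1, h.n2, h.n3, h.n4, h.n5, h.r2, h.r3, h.r4, h.r5, h.r6]
    · intro s h
      refine Runs.seq (Runs.loop (fun r s => InAnswer inp d x ε τ v r (r * (degree x + 1)) s) m
        (by simpa using h) ?_ ?_) ?_
      · intro r s hr h
        refine ⟨?_, ?_⟩
        · rw [Test.Holds, h.r9, h.r4]
          exact Nat.lt_ceil.1 hr
        · refine Runs.seq (Mid := fun s => InAnswer inp d x ε τ v r (r * (degree x + 1)) s ∧
            s.natVar 8 = 0 ∧ s.realVar 10 = 1 ∧ s.realVar 12 = 0) ?_ ?_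
          · refine Runs.straight (by simp) ⟨⟨⟨?_, ?_, ?_, ?_, ?_, ?_, ?_, ?_, ?_, ?_, ?_⟩,
              ?_, ?_, ?_, ?_⟩, ?_, ?_, ?_⟩ <;>
            simp [h.n0, h.n1, h.n2, h.n3, h.n4, h.n5, h.n10, h.r2, h.r3, h.r4, h.r5, h.r6, h.r9,
              h.r20, h.r21]
          · rintro s ⟨h, h8, h10, h12⟩
            refine Runs.seq (runs_readTuple h h8 h10 h12 (hτ r hr)) ?_
            rintro s ⟨h, h10⟩
            refine Runs.straight (by simp) ⟨⟨?_, ?_, ?_, ?_, ?_, ?_, ?_, ?_, ?_, ?_, ?_⟩,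
              ?_, ?_, ?_, ?_⟩ <;>
            simp [h.n0, h.n1, h.n2, h.n3, h.n4, h.n5, h.n10, h.r2, h.r3, h.r4, h.r5, h.r6, h.r9,
              h.r20, h.r21, h10, hv r hr, Finset.sum_range_succ]
            ring
      · intro s h
        rw [Test.Holds, h.r9, h.r4, not_lt]
        exact Nat.le_ceil _
      · intro s h
        -- The round counter has stopped at the number of rounds, so it serves as the divisor of the
        -- mean.
        refine Runs.straight (by simp) ?_
        simp [h.n5, h.r9, h.r20, estimate]
        ring
  · rw [releaseTime]
    have e1 : 0 ≤ m * (degree x * d) := by positivity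
    have e2 : 0 ≤ degree x * d := by positivity
    have e3 : 0 ≤ m * d := by positivity
    have e4 : 0 ≤ m * degree x := by positivity
    nlinarith

end Answer

/-! ### Finite products of a uniform distribution -/

open Classical in
/-- If every value of `f` is at most `c` times as frequent as for `g`, then every event of `m`
independent values is at most `c ^ m` times as frequent. -/
theorem card_filter_comp_le {A R : Type*} [Fintype A] (f g : A → R) {c : ℝ}
    (h : ∀ ρ, (Nat.card {a // f a = ρ} : ℝ) ≤ c * Nat.card {a // g a = ρ})
    (m : ℕ) (E : Set (Fin m → R)) :
    ((Finset.univ.filter fun a : Fin m → A => f ∘ a ∈ E).card : ℝ) ≤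
      c ^ m * (Finset.univ.filter fun a : Fin m → A => g ∘ a ∈ E).card := by
  simp only [Nat.card_eq_fintype_card] at h
  have fiber : ∀ (f : A → R) (ρ : Fin m → R),
      (Finset.univ.filter fun a : Fin m → A => f ∘ a = ρ).card =
        ∏ r, Fintype.card {a // f a = ρ r} := by
    intro f ρ
    have : (Finset.univ.filter fun a : Fin m → A => f ∘ a = ρ) =
        Fintype.piFinset fun r => Finset.univ.filter fun a => f a = ρ r := by
      ext a; simp [funext_iff]
    rw [this, Fintype.card_piFinset]
    exact Finset.prod_congr rfl fun r _ => (Fintype.card_subtype _).symm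
  -- `R` may be infinite, so the sum over outcomes is restricted to the finitely many that `f` or
  -- `g` attains in `E`. The fibre over an outcome is a product of m fibres, which are compared one
  -- by one.
  set T : Finset (Fin m → R) :=
    ((Finset.univ.image fun a : Fin m → A => f ∘ a) ∪
      (Finset.univ.image fun a : Fin m → A => g ∘ a)).filter (· ∈ E) with hT
  have total : ∀ F : A → R, (∀ a : Fin m → A, F ∘ a ∈ E → F ∘ a ∈ T) →
      (Finset.univ.filter fun a : Fin m → A => F ∘ a ∈ E).card =
        ∑ ρ ∈ T, (Finset.univ.filter fun a : Fin m → A => F ∘ a = ρ).card := by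
    intro F hF
    rw [Finset.card_eq_sum_card_fiberwise (f := fun a => F ∘ a) (t := T)
      (fun a ha => hF a (by simpa using ha))]
    refine Finset.sum_congr rfl fun ρ hρ => ?_
    congr 1
    ext a
    simp only [Finset.mem_filter, Finset.mem_univ, true_and, and_iff_right_iff_imp]
    rintro rfl
    exact (Finset.mem_filter.1 hρ).2
  rw [total f fun a ha => by simp only [hT, Finset.mem_filter, Finset.mem_union,
      Finset.mem_image, Finset.mem_univ, true_and]; exact ⟨Or.inl ⟨a, rfl⟩, ha⟩,
    total g fun a ha => by simp only [hT, Finset.mem_filter, Finset.mem_union,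
      Finset.mem_image, Finset.mem_univ, true_and]; exact ⟨Or.inr ⟨a, rfl⟩, ha⟩]
  push_cast
  rw [Finset.mul_sum]
  refine Finset.sum_le_sum fun ρ _ => ?_
  rw [fiber, fiber]
  push_cast
  calc (∏ r, (Fintype.card {a // f a = ρ r} : ℝ))
      ≤ ∏ r, c * (Fintype.card {a // g a = ρ r} : ℝ) :=
        Finset.prod_le_prod (fun _ _ => by positivity) fun r _ => h _
    _ = _ := by rw [Finset.prod_mul_distrib]; simp

/-- The second moment of a sum of independent centred variables. -/
theorem sum_sq_sum_of_centred {A : Type*} [Fintype A] (Z : A → ℝ) (h0 : ∑ a, Z a = 0) (m : ℕ) :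
    (∑ a : Fin m → A, (∑ r, Z (a r)) ^ 2) * Fintype.card A =
      m * (∑ a, Z a ^ 2) * Fintype.card A ^ m := by
  induction m with
  | zero => simp
  | succ m ih =>
    rw [← (Fin.consEquiv fun _ : Fin (m + 1) => A).sum_comp, Fintype.sum_prod_type]
    -- Splitting off one variable leaves a cross term that is linear in Z x; it vanishes on
    -- summation because Z is centred.
    have key : ∀ (x : A) (y : Fin m → A),
        (∑ r, Z ((Fin.consEquiv fun _ : Fin (m + 1) => A) (x, y) r)) ^ 2 =
          Z x ^ 2 + Z x * (2 * ∑ r, Z (y r)) + (∑ r, Z (y r)) ^ 2 := by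
      intro x y
      simp only [Fin.consEquiv_apply, Fin.sum_univ_succ, Fin.cons_zero, Fin.cons_succ]
      ring
    simp only [key, Finset.sum_add_distrib, ← Finset.mul_sum, ← Finset.sum_mul, h0, zero_mul,
      Finset.sum_const, Finset.card_univ, nsmul_eq_mul, Fintype.card_fun, Fintype.card_fin]
    push_cast
    rw [add_zero, add_mul, mul_assoc (Fintype.card A : ℝ), ih]
    ring

/-- The mean squared error of an empirical mean. -/
theorem sum_sq_mean_sub_le {A : Type*} [Fintype A] [Nonempty A] (Y : A → ℝ) {B μ : ℝ}
    (hμ : ∑ a, Y a = Fintype.card A * μ) (hY : ∀ a, |Y a| ≤ B) (g : ℝ) {m : ℕ} (hm : 0 < m) :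
    ∑ a : Fin m → A, ((∑ r, Y (a r)) / m - g) ^ 2 ≤
      (2 * (μ - g) ^ 2 + 2 * (B ^ 2 / m)) * Fintype.card A ^ m := by
  have hc : (0 : ℝ) < Fintype.card A := by exact_mod_cast Fintype.card_pos
  have hm' : (0 : ℝ) < m := by exact_mod_cast hm
  set Z : A → ℝ := fun a => Y a - μ with hZ
  have h0 : ∑ a, Z a = 0 := by
    simp [hZ, hμ]
  have hZ2 : ∑ a, Z a ^ 2 ≤ B ^ 2 * Fintype.card A := by
    have e : ∑ a, Z a ^ 2 = ∑ a, Y a ^ 2 - Fintype.card A * μ ^ 2 := by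
      simp only [hZ, sub_sq, Finset.sum_add_distrib, Finset.sum_sub_distrib, Finset.sum_const,
        Finset.card_univ, nsmul_eq_mul, ← Finset.sum_mul, ← Finset.mul_sum, hμ]
      ring
    have : ∑ a, Y a ^ 2 ≤ ∑ _a : A, B ^ 2 :=
      Finset.sum_le_sum fun a _ => sq_le_sq' (abs_le.1 (hY a)).1 (abs_le.1 (hY a)).2
    simp only [Finset.sum_const, Finset.card_univ, nsmul_eq_mul] at this
    have : 0 ≤ Fintype.card A * μ ^ 2 := by positivity
    linarith
  have hS : ∑ a : Fin m → A, (∑ r, Z (a r)) ^ 2 ≤ m * B ^ 2 * Fintype.card A ^ m := by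
    have := sum_sq_sum_of_centred Z h0 m
    refine le_of_mul_le_mul_right ?_ hc
    rw [this]
    calc m * (∑ a, Z a ^ 2) * (Fintype.card A : ℝ) ^ m
        ≤ m * (B ^ 2 * Fintype.card A) * (Fintype.card A : ℝ) ^ m := by gcongr
      _ = _ := by ring
  -- The error is the bias μ - g plus the fluctuation of the mean; (u + v)² ≤ 2u² + 2v² separates
  -- them.
  have step : ∀ a : Fin m → A, ((∑ r, Y (a r)) / m - g) ^ 2 ≤
      2 * (μ - g) ^ 2 + 2 / m ^ 2 * (∑ r, Z (a r)) ^ 2 := by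
    intro a
    have e : (∑ r, Y (a r)) / m - g = (μ - g) + (∑ r, Z (a r)) / m := by
      simp only [hZ, Finset.sum_sub_distrib, Finset.sum_const, Finset.card_univ, nsmul_eq_mul,
        Fintype.card_fin]
      field_simp
      ring
    rw [e]
    have : 2 / (m : ℝ) ^ 2 * (∑ r, Z (a r)) ^ 2 = 2 * ((∑ r, Z (a r)) / m) ^ 2 := by
      field_simp
    rw [this]
    nlinarith [sq_nonneg ((μ - g) - (∑ r, Z (a r)) / m)]
  calc _ ≤ ∑ a : Fin m → A, (2 * (μ - g) ^ 2 + 2 / m ^ 2 * (∑ r, Z (a r)) ^ 2) :=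
        Finset.sum_le_sum fun a _ => step a
    _ = Fintype.card A ^ m * (2 * (μ - g) ^ 2) +
          2 / m ^ 2 * ∑ a : Fin m → A, (∑ r, Z (a r)) ^ 2 := by
        rw [Finset.sum_add_distrib, Finset.mul_sum, Finset.sum_const, Finset.card_univ]
        simp
    _ ≤ Fintype.card A ^ m * (2 * (μ - g) ^ 2) + 2 / m ^ 2 * (m * B ^ 2 * Fintype.card A ^ m) := by
        gcongr
    _ = _ := by field_simp

/-! ### The approximating polynomial -/

/-- The polynomial of degree `k` that is one at zero and vanishes at `1, …, k`. -/
noncomputable def indicatorPoly (k : ℕ) (s : ℝ) : ℝ :=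
  ∏ j ∈ Finset.range k, (1 - s / ((j : ℝ) + 1))

/-- At s + 1 the factor with index j equals -(s - j)/(j + 1), which is up to sign the ratio of
consecutive binomial coefficients. -/
theorem indicatorPoly_succ (k s : ℕ) :
    indicatorPoly k ((s : ℝ) + 1) = (-1) ^ k * (s.choose k : ℝ) := by
  induction k with
  | zero => simp [indicatorPoly]
  | succ k ih =>
    rw [indicatorPoly, Finset.prod_range_succ, ← indicatorPoly, ih]
    have h : (s.choose (k + 1) : ℝ) * (k + 1) = s.choose k * ((s : ℝ) - k) := by
      rcases le_or_gt k s with hk | hk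
      · have := Nat.choose_succ_right_eq s k
        rw [← Nat.cast_sub hk]
        exact_mod_cast this
      · simp [Nat.choose_eq_zero_of_lt hk, Nat.choose_eq_zero_of_lt (hk.trans (Nat.lt_succ_self k))]
    have h' : (s.choose (k + 1) : ℝ) = s.choose k * ((s : ℝ) - k) / (k + 1) := by
      rw [← h]; field_simp
    rw [h']
    field_simp
    ring

/-- The error vanishes for s ≤ k. For larger s it is a squared binomial coefficient, at most
4^(s-1), and 2^k ≤ 2^(s-1) pays for the denominator. The exponential form is chosen because its mean
factorizes over independent bits. -/
theorem indicatorPoly_error (k s : ℕ) :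
    ((if s = 0 then 1 else 0) - indicatorPoly k s) ^ 2 ≤ 8 ^ s / 2 ^ k := by
  rcases s with _ | s
  · simp [indicatorPoly]
  · rw [if_neg s.succ_ne_zero, Nat.cast_succ, indicatorPoly_succ, zero_sub, neg_sq, mul_pow,
      ← pow_mul, mul_comm k, pow_mul, neg_one_sq, one_pow, one_mul]
    rcases lt_or_ge s k with hk | hk
    · rw [Nat.choose_eq_zero_of_lt hk, Nat.cast_zero, zero_pow two_ne_zero]
      positivity
    · rw [le_div_iff₀ (by positivity)]
      have h1 : (s.choose k : ℝ) ≤ 2 ^ s := by exact_mod_cast Nat.choose_le_two_pow s k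
      have h2 : (2 : ℝ) ^ k ≤ 2 ^ s := pow_le_pow_right₀ one_le_two hk
      calc (s.choose k : ℝ) ^ 2 * 2 ^ k ≤ (2 ^ s) ^ 2 * 2 ^ s := by gcongr
        _ = 8 ^ s := by rw [← pow_mul, ← pow_add, show (8 : ℝ) = 2 ^ 3 by norm_num, ← pow_mul]; ring_nf
        _ ≤ 8 ^ (s + 1) := pow_le_pow_right₀ (by norm_num) (Nat.le_succ s)

/-- The bit `1` or `0`. -/
noncomputable def bit (b : Bool) : ℝ := if b = true then 1 else 0

theorem bit_eq (b : Bool) : bit b = 0 ∨ bit b = 1 := by cases b <;> simp [bit]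

/-- The expectation of a product over independent bits. -/
theorem sum_prod_bits {d : ℕ} (P : Fin d → Bool → ℝ) (h : Fin d → Bool → ℝ) :
    ∑ S : Fin d → Bool, (∏ i, P i (S i)) * ∏ i, h i (S i) =
      ∏ i, (P i true * h i true + P i false * h i false) := by
  simp_rw [← Finset.prod_mul_distrib]
  rw [← Fintype.piFinset_univ,
    ← Finset.prod_univ_sum (fun _ => Finset.univ) fun i b => P i b * h i b]
  simp

/-- Bernoulli's inequality gives 1 + 7y ≤ (1 + y)^7, and (1 + y)(1 - y) ≤ 1. Multiplied over the
attributes, this bounds the mean of 8^s by the (-7)-th power of the probability that s = 0. -/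
theorem one_add_seven_mul_le {y : ℝ} (h0 : 0 ≤ y) (h1 : y ≤ 1) :
    (1 + 7 * y) * (1 - y) ^ 7 ≤ 1 := by
  have h := one_add_mul_le_pow (show -2 ≤ y by linarith) 7
  push_cast at h
  calc (1 + 7 * y) * (1 - y) ^ 7 ≤ (1 + y) ^ 7 * (1 - y) ^ 7 :=
        mul_le_mul_of_nonneg_right h (pow_nonneg (by linarith) 7)
    _ = (1 - y ^ 2) ^ 7 := by rw [← mul_pow]; ring
    _ ≤ 1 := pow_le_one₀ (by nlinarith) (by nlinarith)

/-- The mean squared error of the approximation for one entry `z` of the data set. -/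
theorem approx_error {d k : ℕ} {P : Fin d → Bool → ℝ} (hP : ∀ i b, 0 ≤ P i b)
    (hP1 : ∀ i, P i true + P i false = 1) {z : Fin d → ℝ} (hz : ∀ i, z i = 0 ∨ z i = 1) {x : ℝ}
    (hx : 0 < x) (hk : (1 / x) ^ 8 ≤ 2 ^ k) :
    ∑ S : Fin d → Bool, (∏ i, P i (S i)) * (∏ i, (1 - z i * bit (S i)) -
      (if ∏ i, (1 - z i * P i true) < x then 0 else 1) *
        indicatorPoly k (∑ i, z i * bit (S i))) ^ 2 ≤ x := by
  have hp : ∀ S : Fin d → Bool, 0 ≤ ∏ i, P i (S i) := fun S => Finset.prod_nonneg fun i _ => hP _ _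
  have hPf : ∀ i, P i false = 1 - P i true := fun i => by linarith [hP1 i]
  have hf : ∀ S : Fin d → Bool, (∏ i, (1 - z i * bit (S i))) ^ 2 = ∏ i, (1 - z i * bit (S i)) := by
    intro S
    rw [← Finset.prod_pow]
    refine Finset.prod_congr rfl fun i _ => ?_
    rcases hz i with h | h <;> rcases bit_eq (S i) with h' | h' <;> simp [h, h']
  have hy0 : ∀ i, 0 ≤ z i * P i true := fun i => by
    rcases hz i with h | h <;> simp [h, hP]
  have hy1 : ∀ i, z i * P i true ≤ 1 := fun i => by
    rcases hz i with h | h <;> simp [h]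
    linarith [hP1 i, hP i false]
  by_cases hw : ∏ i, (1 - z i * P i true) < x
  -- A dropped entry is approximated by zero; since the indicator is its own square, the error is
  -- the probability that s = 0, which is below x.
  · simp only [hw, if_true, zero_mul, sub_zero, hf]
    rw [sum_prod_bits P (fun i b => 1 - z i * bit b)]
    refine le_trans (le_of_eq ?_) hw.le
    refine Finset.prod_congr rfl fun i _ => ?_
    simp [bit, hPf]
    ring
  · simp only [hw, if_false, one_mul]
    have key : ∀ S : Fin d → Bool, (∏ i, (1 - z i * bit (S i)) -
        indicatorPoly k (∑ i, z i * bit (S i))) ^ 2 ≤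
        (∏ i, (1 + 7 * (z i * bit (S i)))) / 2 ^ k := by
      intro S
      have hzb : ∀ i, z i * bit (S i) = ((if z i * bit (S i) = 0 then 0 else 1 : ℕ) : ℝ) := by
        intro i
        rcases hz i with h | h <;> rcases bit_eq (S i) with h' | h' <;> simp [h, h']
      set s : ℕ := ∑ i, if z i * bit (S i) = 0 then 0 else 1 with hs
      have h1 : ∑ i, z i * bit (S i) = (s : ℝ) := by
        rw [hs, Nat.cast_sum]
        exact Finset.sum_congr rfl fun i _ => hzb i
      have h2 : ∏ i, (1 - z i * bit (S i)) = if s = 0 then 1 else 0 := by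
        split_ifs with h
        · rw [hs, Finset.sum_eq_zero_iff] at h
          refine Finset.prod_eq_one fun i hi => ?_
          rw [hzb i, h i hi]
          simp
        · rw [hs, Finset.sum_eq_zero_iff] at h
          push Not at h
          obtain ⟨i, hi, hne⟩ := h
          refine Finset.prod_eq_zero hi ?_
          rw [hzb i]
          split_ifs at hne ⊢ <;> simp_all
      have h3 : ∏ i, (1 + 7 * (z i * bit (S i))) = 8 ^ s := by
        rw [hs, ← Finset.prod_pow_eq_pow_sum]
        refine Finset.prod_congr rfl fun i _ => ?_
        rcases hz i with h | h <;> rcases bit_eq (S i) with h' | h' <;> norm_num [h, h']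
      rw [h1, h2, h3]
      exact indicatorPoly_error k s
    calc _ ≤ ∑ S : Fin d → Bool, (∏ i, P i (S i)) *
          ((∏ i, (1 + 7 * (z i * bit (S i)))) / 2 ^ k) :=
          Finset.sum_le_sum fun S _ => mul_le_mul_of_nonneg_left (key S) (hp S)
      _ = (∏ i, (1 + 7 * (z i * P i true))) / 2 ^ k := by
          simp_rw [← mul_div_assoc]
          rw [← Finset.sum_div, sum_prod_bits P (fun i b => 1 + 7 * (z i * bit b))]
          congr 1
          refine Finset.prod_congr rfl fun i _ => ?_
          simp [bit, hPf]
          ring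
      _ ≤ x := by
          have h1 : (∏ i, (1 + 7 * (z i * P i true))) * (∏ i, (1 - z i * P i true)) ^ 7 ≤ 1 := by
            rw [← Finset.prod_pow, ← Finset.prod_mul_distrib]
            refine Finset.prod_le_one (fun i _ => ?_) fun i _ =>
              one_add_seven_mul_le (hy0 i) (hy1 i)
            have := hy0 i
            have := hy1 i
            exact mul_nonneg (by linarith) (pow_nonneg (by linarith) 7)
          have h0 : 0 ≤ ∏ i, (1 + 7 * (z i * P i true)) :=
            Finset.prod_nonneg fun i _ => by linarith [hy0 i]
          have h2 : (∏ i, (1 + 7 * (z i * P i true))) * x ^ 7 ≤ 1 :=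
            le_trans (by gcongr; exact not_lt.1 hw) h1
          rw [div_le_iff₀ (by positivity)]
          have h3 : 1 ≤ 2 ^ k * x ^ 8 := by
            rw [div_pow, one_pow, div_le_iff₀ (by positivity)] at hk
            exact hk
          have h4 : (∏ i, (1 + 7 * (z i * P i true))) * x ^ 7 ≤ x * 2 ^ k * x ^ 7 :=
            h2.trans (h3.trans (le_of_eq (by ring)))
          exact le_of_mul_le_mul_right h4 (by positivity)

/-! ### The law of the draws -/

instance : IsProbabilityMeasure tapeMeasure := by
  unfold tapeMeasure; infer_instance

theorem draw_lt (ω : Tape) (q : ℕ) {M : ℕ} (hM : 0 < M) : draw ω q M < M := by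
  unfold draw; omega

theorem measurable_draw (q M : ℕ) : Measurable fun ω : Tape => draw ω q M := by
  have h : Measurable fun ω : Tape => ((ω q : ℝ) * (M : ℝ)) :=
    (measurable_subtype_coe.comp (measurable_pi_apply q)).mul_const _
  exact (Nat.measurable_floor.comp h).min measurable_const

/-- The event lies between a half-open and a closed interval of length 1/M. The truncation at M - 1
acts only at y = 1, a null event. -/
theorem volume_draw {M v : ℕ} (hv : v < M) :
    (volume : Measure unitInterval) {y | min ⌊(y : ℝ) * (M : ℝ)⌋₊ (M - 1) = v} =
      ENNReal.ofReal (1 / M) := by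
  have hM : (0 : ℝ) < M := by exact_mod_cast (Nat.zero_le v).trans_lt hv
  have hv' : (v : ℝ) + 1 ≤ M := by exact_mod_cast hv
  have hv0 : (0 : ℝ) ≤ v := v.cast_nonneg
  let l : unitInterval := ⟨v / M, by positivity, by rw [div_le_one hM]; linarith⟩
  let u : unitInterval := ⟨(v + 1) / M, by positivity, by rwa [div_le_one hM]⟩
  have hlen : (u : ℝ) - l = 1 / M := by simp only [l, u]; ring
  apply le_antisymm
  · calc _ ≤ (volume : Measure unitInterval) (Set.Icc l u) := by
          refine measure_mono fun y hy => ?_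
          have hy0 : 0 ≤ (y : ℝ) * M := mul_nonneg y.2.1 hM.le
          have h1 : v ≤ ⌊(y : ℝ) * (M : ℝ)⌋₊ := by
            have : min ⌊(y : ℝ) * (M : ℝ)⌋₊ (M - 1) = v := hy
            omega
          have h2 : ⌊(y : ℝ) * (M : ℝ)⌋₊ = v ∨ v + 1 = M := by
            have : min ⌊(y : ℝ) * (M : ℝ)⌋₊ (M - 1) = v := hy
            omega
          constructor
          · change (v : ℝ) / M ≤ y
            rw [div_le_iff₀ hM]
            exact (Nat.le_floor_iff hy0).1 h1
          · change (y : ℝ) ≤ (v + 1) / M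
            rw [le_div_iff₀ hM]
            rcases h2 with h2 | h2
            · rw [← h2]
              exact (Nat.lt_floor_add_one _).le
            · have : (v : ℝ) + 1 = M := by exact_mod_cast h2
              rw [this]
              exact mul_le_of_le_one_left hM.le y.2.2
      _ = _ := by rw [unitInterval.volume_Icc, hlen]
  · calc _ = (volume : Measure unitInterval) (Set.Ico l u) := by
          rw [unitInterval.volume_Ico, hlen]
      _ ≤ _ := by
          refine measure_mono fun y hy => ?_
          have hy0 : 0 ≤ (y : ℝ) * M := mul_nonneg y.2.1 hM.le
          have h1 : (v : ℝ) / M ≤ y := hy.1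
          have h2 : (y : ℝ) < (v + 1) / M := hy.2
          rw [div_le_iff₀ hM] at h1
          rw [lt_div_iff₀ hM] at h2
          have : ⌊(y : ℝ) * (M : ℝ)⌋₊ = v := (Nat.floor_eq_iff hy0).2 ⟨h1, h2⟩
          change min ⌊(y : ℝ) * (M : ℝ)⌋₊ (M - 1) = v
          omega

/-- The random choices of one round: a row and a tuple of attributes. -/
abbrev Seed (n d k : ℕ) : Type := Fin (n + n + n) × (Fin k → Fin (d + 1))

/-- The random choices of the first `m` rounds. -/
noncomputable def seeds {n : ℕ} (hn : 0 < n) (d k m : ℕ) (ω : Tape) : Fin m → Seed n d k := fun r =>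
  (⟨draw ω (r * (k + 1)) (n + n + n), draw_lt _ _ (by omega)⟩,
    fun j => ⟨draw ω (r * (k + 1) + 1 + j) (d + 1), draw_lt _ _ d.succ_pos⟩)

/-- The number of possible values of the draws in a round. -/
def seedSize (n d k : ℕ) : Fin (k + 1) → ℕ := Fin.cons (n + n + n) fun _ => d + 1

/-- The draws in a round. -/
def seedValue {n d k : ℕ} (a : Seed n d k) : Fin (k + 1) → ℕ := Fin.cons a.1 fun j => a.2 j

theorem seedValue_lt {n d k : ℕ} (a : Seed n d k) (j : Fin (k + 1)) :
    seedValue a j < seedSize n d k j := by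
  refine Fin.cases ?_ (fun j => ?_) j
  · exact a.1.2
  · exact (a.2 j).2

theorem seeds_eq_iff {n d k m : ℕ} (hn : 0 < n) (ω : Tape) (a : Fin m → Seed n d k) :
    seeds hn d k m ω = a ↔
      ∀ i : Fin m × Fin (k + 1), draw ω (i.1 * (k + 1) + i.2) (seedSize n d k i.2) =
        seedValue (a i.1) i.2 := by
  simp only [funext_iff, Prod.ext_iff, Prod.forall, Fin.forall_fin_succ (n := k), seeds, seedSize,
    seedValue, Fin.cons_zero, Fin.cons_succ, Fin.ext_iff, Fin.val_zero, add_zero, Fin.val_succ]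
  refine forall_congr' fun r => and_congr_right fun _ => forall_congr' fun j => ?_
  rw [show (r : ℕ) * (k + 1) + (j + 1) = r * (k + 1) + 1 + j by ring]

theorem injective_tapeIndex (m k : ℕ) :
    Function.Injective fun i : Fin m × Fin (k + 1) => (i.1 : ℕ) * (k + 1) + i.2 := by
  rintro ⟨r, j⟩ ⟨r', j'⟩ h
  apply finProdFinEquiv.injective
  ext
  simp only [finProdFinEquiv_apply_val]
  simp only at h
  rw [add_comm, mul_comm, h]
  ring

theorem measurableSet_seeds_eq {n d k m : ℕ} (hn : 0 < n) (a : Fin m → Seed n d k) :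
    MeasurableSet {ω | seeds hn d k m ω = a} := by
  simp only [seeds_eq_iff, Set.ofPred_forall]
  exact MeasurableSet.iInter fun i => measurable_draw _ _ (measurableSet_singleton _)

/-- The draws come from distinct cells of the tape, hence are independent. What matters is that the
right-hand side does not depend on `a`. -/
theorem tapeMeasure_seeds_eq {n d k m : ℕ} (hn : 0 < n) (a : Fin m → Seed n d k) :
    tapeMeasure {ω | seeds hn d k m ω = a} =
      ∏ i : Fin m × Fin (k + 1), ENNReal.ofReal (1 / seedSize n d k i.2) := by
  have hind := (ProbabilityTheory.iIndepFun_infinitePi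
    (P := fun _ : ℕ => (volume : Measure unitInterval)) (X := fun _ y => y)
    fun _ => measurable_id).precomp (injective_tapeIndex m k)
  have hB : ∀ i : Fin m × Fin (k + 1), MeasurableSet {y : unitInterval |
      min ⌊(y : ℝ) * (seedSize n d k i.2 : ℝ)⌋₊ (seedSize n d k i.2 - 1) =
        seedValue (a i.1) i.2} := fun i => by
    have h : Measurable fun y : unitInterval => ((y : ℝ) * (seedSize n d k i.2 : ℝ)) :=
      measurable_subtype_coe.mul_const _
    exact (Nat.measurable_floor.comp h).min measurable_const (measurableSet_singleton _)
  have := hind.measure_inter_preimage_eq_mul Finset.univ fun i _ => hB i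
  have hset : {ω | seeds hn d k m ω = a} = ⋂ i ∈ (Finset.univ : Finset (Fin m × Fin (k + 1))),
      (fun ω : Tape => ω (i.1 * (k + 1) + i.2)) ⁻¹' {y : unitInterval |
        min ⌊(y : ℝ) * (seedSize n d k i.2 : ℝ)⌋₊ (seedSize n d k i.2 - 1) =
          seedValue (a i.1) i.2} := by
    ext ω
    simp only [seeds_eq_iff, draw, Set.mem_ofPred_eq, Finset.mem_univ, Set.iInter_true,
      Set.mem_iInter, Set.mem_preimage]
  rw [hset]
  refine this.trans (Finset.prod_congr rfl fun i _ => ?_)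
  rw [← volume_draw (seedValue_lt (a i.1) i.2),
    ← Measure.infinitePi_map_eval (fun _ : ℕ => (volume : Measure unitInterval))
      ((i.1 : ℕ) * (k + 1) + i.2), Measure.map_apply (measurable_pi_apply _) ]
  rw [Measure.infinitePi_map_eval]
  exact hB i

open Classical in
/-- The random choices are uniformly distributed. -/
theorem tapeMeasure_seeds_mem {n d k m : ℕ} (hn : 0 < n) (p : (Fin m → Seed n d k) → Prop) :
    tapeMeasure.real {ω | p (seeds hn d k m ω)} =
      (Finset.univ.filter p).card / (Fintype.card (Seed n d k) : ℝ) ^ m := by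
  set c := (∏ i : Fin m × Fin (k + 1), ENNReal.ofReal (1 / seedSize n d k i.2)).toReal with hc
  have key : ∀ p : (Fin m → Seed n d k) → Prop,
      tapeMeasure.real {ω | p (seeds hn d k m ω)} = (Finset.univ.filter p).card * c := by
    intro p
    have hset : {ω | p (seeds hn d k m ω)} =
        ⋃ a ∈ Finset.univ.filter p, {ω | seeds hn d k m ω = a} := by
      ext ω; simp
    rw [hset, measureReal_biUnion_finset]
    · simp only [Measure.real, tapeMeasure_seeds_eq, ← hc, Finset.sum_const, nsmul_eq_mul]
    · intro a _ b _ hab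
      rw [Function.onFun, Set.disjoint_left]
      rintro ω rfl h
      exact hab h
    · exact fun a _ => measurableSet_seeds_eq hn a
  -- The common weight `c` need not be evaluated: the sure event determines it.
  have h1 := key fun _ => True
  simp only [Set.ofPred_true, probReal_univ, Finset.filter_true, Finset.card_univ,
    Fintype.card_fun, Fintype.card_fin, Nat.cast_pow] at h1
  rw [key p, eq_div_iff, mul_assoc, mul_comm c, ← h1, mul_one]
  intro h0
  rw [h0, zero_mul] at h1
  exact one_ne_zero h1

/-! ### The time bound -/

theorem cutoff_pos {α β : ℝ} (hα : 0 < α) (hβ : 0 < β) : 0 < cutoff α β := by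
  unfold cutoff; positivity

theorem sampleBound_pos {d : ℕ} {x : ℝ} (hx : 0 < x) : 0 < sampleBound d x := by
  unfold sampleBound; positivity

/-- Let T be the exponent without its constant. Since T ≥ 1/2 and d ≥ 2, constants and fixed powers
of d are powers d^(cT). The rest follows from 1/x ≤ e^(4T), which bounds both k and the number of
rounds. -/
theorem releaseTime_le {α β : ℝ} (hα : 0 < α) (hβ : 0 < β) {d : ℕ} (hd : 2 ≤ d) :
    (releaseTime d (degree (cutoff α β)) ⌈sampleBound d (cutoff α β)⌉₊ : ℝ) ≤
      (d : ℝ) ^ timeExponent 400 α β := by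
  set a := min α 1 with ha
  set b := min β 1 with hb
  set x := cutoff α β with hx
  set k := degree x with hk
  have ha0 : 0 < a := lt_min hα one_pos
  have hb0 : 0 < b := lt_min hβ one_pos
  have ha1 : a ≤ 1 := min_le_right _ _
  have hb1 : b ≤ 1 := min_le_right _ _
  have hx0 : 0 < x := cutoff_pos hα hβ
  have hlog2 : (1 : ℝ) / 2 < Real.log 2 := by linarith [Real.log_two_gt_d9]
  set H := Real.log (2 / b) with hH
  have hH2 : Real.log 2 ≤ H := Real.log_le_log two_pos (by rw [le_div_iff₀ hb0]; linarith)
  set T := 1 / a ^ 2 * H with hT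
  have hinv : 1 ≤ 1 / a ^ 2 := by
    rw [le_div_iff₀ (by positivity), one_mul]
    exact pow_le_one₀ ha0.le ha1
  have hTH : H ≤ T := le_mul_of_one_le_left (by linarith) hinv
  have hTa : 1 / a ^ 2 ≤ 2 * T := by
    rw [hT]
    have : 1 / a ^ 2 * (1 / 2) ≤ 1 / a ^ 2 * H := by gcongr; linarith
    linarith
  have hT2 : 1 / 2 ≤ T := by linarith
  have hexp : timeExponent 400 α β = 400 * T := by
    rw [timeExponent, hT]; ring
  have hd' : (2 : ℝ) ≤ d := by exact_mod_cast hd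
  have hd0 : (0 : ℝ) < d := by linarith
  have hd1 : (1 : ℝ) ≤ d := by linarith
  have mono : ∀ {y z : ℝ}, y ≤ z → (d : ℝ) ^ y ≤ (d : ℝ) ^ z := fun h =>
    Real.rpow_le_rpow_of_exponent_le hd1 h
  have hxinv : 1 / x ≤ Real.exp (4 * T) := by
    have h1 : 1 / a ^ 2 ≤ Real.exp (2 * T) :=
      (hTa.trans (by linarith)).trans (Real.add_one_le_exp (2 * T))
    have h2 : (2 / b) ^ 2 ≤ Real.exp (2 * T) := by
      have : 2 / b = Real.exp H := (Real.exp_log (by positivity)).symm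
      rw [this, ← Real.exp_nat_mul]
      exact Real.exp_le_exp.2 (by push_cast; linarith)
    have h3 : 1 / x ≤ 1 / a ^ 2 * (2 / b) ^ 2 := by
      have haα : a ≤ α := min_le_left _ _
      have hbβ : b ≤ β := min_le_left _ _
      have e : 1 / a ^ 2 * (2 / b) ^ 2 = 1 / (a * b * (a * b) * (1 / 4)) := by
        field_simp
        norm_num
      rw [e, hx, cutoff]
      gcongr
    calc 1 / x ≤ 1 / a ^ 2 * (2 / b) ^ 2 := h3
      _ ≤ Real.exp (2 * T) * Real.exp (2 * T) := by gcongr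
      _ = _ := by rw [← Real.exp_add]; ring_nf
  have hexpd : Real.exp (4 * T) ≤ (d : ℝ) ^ (8 * T) := by
    rw [Real.rpow_def_of_pos hd0, Real.exp_le_exp]
    have : Real.log 2 ≤ Real.log d := Real.log_le_log two_pos hd'
    nlinarith
  -- Minimality of k gives 2^(k-1) < e^(32T), so k - 1 < 64T because log 2 > 1/2; the remaining 1 is
  -- at most 2T.
  have hkT : (k : ℝ) ≤ 66 * T := by
    rcases Nat.eq_zero_or_pos k with h | h
    · rw [h]; push_cast; linarith
    · have h1 : (2 : ℝ) ^ (k - 1) < (1 / x) ^ 8 := lt_of_lt_degree (by omega)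
      have h2 : (1 / x) ^ 8 ≤ Real.exp (32 * T) := by
        calc (1 / x) ^ 8 ≤ Real.exp (4 * T) ^ 8 := by gcongr
          _ = _ := by rw [← Real.exp_nat_mul]; push_cast; ring_nf
      have h3 := Real.log_lt_log (by positivity) (h1.trans_le h2)
      rw [Real.log_exp, Real.log_pow, Nat.cast_sub h, Nat.cast_one] at h3
      have hk1 : (1 : ℝ) ≤ k := by exact_mod_cast h
      nlinarith
  have hdp : (d : ℝ) + 1 ≤ (d : ℝ) ^ (4 * T) := by
    calc (d : ℝ) + 1 ≤ (d : ℝ) ^ (2 : ℝ) := by rw [Real.rpow_two]; nlinarith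
      _ ≤ _ := mono (by linarith)
  have hkp : (k : ℝ) + 1 ≤ (d : ℝ) ^ (66 * T) := by
    calc (k : ℝ) + 1 ≤ 2 ^ k := by exact_mod_cast Nat.lt_two_pow_self
      _ ≤ (d : ℝ) ^ k := by gcongr
      _ = (d : ℝ) ^ (k : ℝ) := (Real.rpow_natCast _ _).symm
      _ ≤ _ := mono hkT
  have hS : sampleBound d x ≤ (d : ℝ) ^ (276 * T) := by
    have h4 : (4 : ℝ) ≤ (d : ℝ) ^ (4 * T) := by
      calc (4 : ℝ) ≤ (d : ℝ) ^ (2 : ℝ) := by rw [Real.rpow_two]; nlinarith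
        _ ≤ _ := mono (by linarith)
    have h5 : (((d : ℝ) + 1) * ((d : ℝ) + 1)) ^ k ≤ (d : ℝ) ^ (264 * T) := by
      calc (((d : ℝ) + 1) * ((d : ℝ) + 1)) ^ k ≤ ((d : ℝ) ^ 4) ^ k := by
            gcongr
            have : (d : ℝ) + 1 ≤ (d : ℝ) ^ 2 := by nlinarith
            calc ((d : ℝ) + 1) * ((d : ℝ) + 1) ≤ (d : ℝ) ^ 2 * (d : ℝ) ^ 2 := by gcongr
              _ = _ := by ring
        _ = (d : ℝ) ^ (4 * k : ℝ) := by
            rw [← pow_mul, ← Real.rpow_natCast]; push_cast; rfl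
        _ ≤ _ := mono (by linarith)
    calc sampleBound d x = 4 * (1 / x) * (((d : ℝ) + 1) * ((d : ℝ) + 1)) ^ k := by
          rw [sampleBound, ← hk]; ring
      _ ≤ (d : ℝ) ^ (4 * T) * (d : ℝ) ^ (8 * T) * (d : ℝ) ^ (264 * T) := by
          gcongr
          exact hxinv.trans hexpd
      _ = _ := by rw [← Real.rpow_add hd0, ← Real.rpow_add hd0]; ring_nf
  have hm : (⌈sampleBound d x⌉₊ : ℝ) + 1 ≤ (d : ℝ) ^ (278 * T) := by
    have h1 := (Nat.ceil_lt_add_one (sampleBound_pos (d := d) hx0).le).le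
    have h2 : (2 : ℝ) ≤ (d : ℝ) ^ (276 * T) := by
      calc (2 : ℝ) ≤ (d : ℝ) ^ (1 : ℝ) := by rwa [Real.rpow_one]
        _ ≤ _ := mono (by linarith)
    calc (⌈sampleBound d x⌉₊ : ℝ) + 1 ≤ 2 * (d : ℝ) ^ (276 * T) := by linarith
      _ ≤ (d : ℝ) ^ (1 : ℝ) * (d : ℝ) ^ (276 * T) := by rw [Real.rpow_one]; gcongr
      _ ≤ _ := by rw [← Real.rpow_add hd0]; exact mono (by linarith)
  have h100 : (100 : ℝ) ≤ (d : ℝ) ^ (14 * T) := by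
    calc (100 : ℝ) ≤ 2 ^ 7 := by norm_num
      _ ≤ (d : ℝ) ^ 7 := by gcongr
      _ = (d : ℝ) ^ (7 : ℝ) := by rw [← Real.rpow_natCast]; norm_num
      _ ≤ _ := mono (by linarith)
  rw [hexp]
  set m : ℝ := (⌈sampleBound d x⌉₊ : ℝ) with hmdef
  have hm0 : 0 ≤ m := Nat.cast_nonneg _
  have hk0 : (0 : ℝ) ≤ k := Nat.cast_nonneg _
  have hprod : 1 ≤ (m + 1) * (k + 1) * (d + 1) :=
    one_le_mul_of_one_le_of_one_le
      (one_le_mul_of_one_le_of_one_le (by linarith) (by linarith)) (by linarith)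
  calc (releaseTime d k ⌈sampleBound d x⌉₊ : ℝ)
      = 50 + 50 * ((m + 1) * (k + 1) * (d + 1)) := by rw [releaseTime]; push_cast; ring
    _ ≤ 100 * ((m + 1) * (k + 1) * (d + 1)) := by linarith
    _ ≤ (d : ℝ) ^ (14 * T) * ((d : ℝ) ^ (278 * T) * (d : ℝ) ^ (66 * T) * (d : ℝ) ^ (4 * T)) := by
        gcongr
    _ = (d : ℝ) ^ (362 * T) := by
        rw [← Real.rpow_add hd0, ← Real.rpow_add hd0, ← Real.rpow_add hd0]; ring_nf
    _ ≤ _ := mono (by linarith)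

/-- This lets one exponent serve for time and for sample size: a data set that is large compared
with the time bound passes the size test of the release program. -/
theorem sampleBound_add_one_lt {d k : ℕ} {x : ℝ} :
    sampleBound d x + 1 < releaseTime d k ⌈sampleBound d x⌉₊ := by
  have h := Nat.le_ceil (sampleBound d x)
  have hN : ⌈sampleBound d x⌉₊ + 1 < releaseTime d k ⌈sampleBound d x⌉₊ := by
    rw [releaseTime]
    have : ⌈sampleBound d x⌉₊ + 1 ≤ 50 * (⌈sampleBound d x⌉₊ + 1) * (k + 1) * (d + 1) := by
      calc ⌈sampleBound d x⌉₊ + 1 ≤ 50 * (⌈sampleBound d x⌉₊ + 1) := by omega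
        _ ≤ 50 * (⌈sampleBound d x⌉₊ + 1) * (k + 1) := Nat.le_mul_of_pos_right _ k.succ_pos
        _ ≤ _ := Nat.le_mul_of_pos_right _ d.succ_pos
    omega
  have : ((⌈sampleBound d x⌉₊ + 1 : ℕ) : ℝ) < releaseTime d k ⌈sampleBound d x⌉₊ :=
    Nat.cast_lt.2 hN
  push_cast at this
  linarith

/-! ### The estimator of one round -/

section Estimator

variable {d n k : ℕ} {x : ℝ} {p : ℕ → ℝ} {Z Z' : ℕ → ℕ → ℝ} {σ : ℕ → ℝ}

/-- The tuple of attributes of a seed. -/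
def seedTuple (a : Seed n d k) (j : ℕ) : ℕ := if h : j < k then a.2 ⟨j, h⟩ else 0

/-- The number that is released in a round. -/
noncomputable def seedNumber (x : ℝ) (p : ℕ → ℝ) (Z : ℕ → ℕ → ℝ) (a : Seed n d k) : ℝ :=
  3 * noisyBit d n k x p Z a.1 (seedTuple a) - 1

/-- The contribution of a round to the estimated answer. -/
noncomputable def seedEstimate (x : ℝ) (p : ℕ → ℝ) (Z : ℕ → ℕ → ℝ) (σ : ℕ → ℝ)
    (a : Seed n d k) : ℝ :=
  tupleFactor d k σ (seedTuple a) * seedNumber x p Z a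

theorem noisyBit_congr_tuple {i : ℕ} {τ τ' : ℕ → ℕ} (h : ∀ j < k, τ j = τ' j) :
    noisyBit d n k x p Z i τ = noisyBit d n k x p Z i τ' := by
  have : tupleProd d (Z i) k τ = tupleProd d (Z i) k τ' :=
    Finset.prod_congr rfl fun j hj => by rw [h j (Finset.mem_range.1 hj)]
  simp only [noisyBit, keptProd, this]

theorem noisyBit_congr_row {i : ℕ} {τ : ℕ → ℕ} (h : i < n → Z i = Z' i) :
    noisyBit d n k x p Z i τ = noisyBit d n k x p Z' i τ := by
  unfold noisyBit
  split_ifs with hi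
  · have hm : missProb d p Z i = missProb d p Z' i := by simp only [missProb, h hi]
    rw [keptProd, keptProd, hm, h hi]
  · rfl
  · rfl

theorem tupleProd_mem {z : ℕ → ℝ} (hz : ∀ j, z j = 0 ∨ z j = 1) (τ : ℕ → ℕ) :
    tupleProd d z k τ = 0 ∨ tupleProd d z k τ = 1 := by
  induction k with
  | zero => simp [tupleProd]
  | succ k ih =>
    rw [tupleProd, Finset.prod_range_succ, ← tupleProd]
    by_cases hk : τ k < d <;> rcases ih with h | h <;> simp [h, hk, hz]

theorem noisyBit_mem (hZ : ∀ i j, Z i j = 0 ∨ Z i j = 1) (i : ℕ) (τ : ℕ → ℕ) :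
    noisyBit d n k x p Z i τ = 0 ∨ noisyBit d n k x p Z i τ = 1 := by
  have h := tupleProd_mem (d := d) (k := k) (hZ i) τ
  unfold noisyBit keptProd
  split_ifs <;> simp [h]

/-- The attributes below d give the linear term and the extra attribute d the constant term. The
coefficients carry a factor d + 1 to offset the probability 1/(d+1) of a draw. -/
theorem sum_factor_mul (z σ : ℕ → ℝ) (j : ℕ) :
    ∑ u : Fin (d + 1), factor d σ j u * (if (u : ℕ) < d then z u else 1) =
      (d + 1) * (1 - (∑ i ∈ Finset.range d, z i * σ i) / (j + 1)) := by
  rw [Fin.sum_univ_castSucc, Finset.sum_range]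
  simp only [factor, Fin.val_castSucc, Fin.is_lt, if_true, Fin.val_last, lt_irrefl, if_false,
    mul_one, zero_sub]
  have : ∀ i : Fin d, -(σ i * ((d : ℝ) + 1) / (j + 1)) * z i =
      (-((d : ℝ) + 1) / (j + 1)) * (z i * σ i) := fun i => by ring
  simp only [this, ← Finset.mul_sum]
  ring

theorem sum_tupleFactor_mul (z σ : ℕ → ℝ) :
    ∑ t : Fin k → Fin (d + 1), tupleFactor d k σ (fun j => if h : j < k then t ⟨j, h⟩ else 0) *
      tupleProd d z k (fun j => if h : j < k then t ⟨j, h⟩ else 0) =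
      (d + 1) ^ k * indicatorPoly k (∑ i ∈ Finset.range d, z i * σ i) := by
  have h : ∀ t : Fin k → Fin (d + 1),
      tupleFactor d k σ (fun j => if h : j < k then t ⟨j, h⟩ else 0) *
        tupleProd d z k (fun j => if h : j < k then t ⟨j, h⟩ else 0) =
      ∏ j : Fin k, factor d σ j (t j) * (if (t j : ℕ) < d then z (t j) else 1) := by
    intro t
    rw [tupleFactor, tupleProd, ← Finset.prod_mul_distrib, Finset.prod_range]
    simp
  simp only [h]
  rw [← Fintype.piFinset_univ, ← Finset.prod_univ_sum (fun _ => Finset.univ)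
    fun (j : Fin k) (u : Fin (d + 1)) => factor d σ j u * (if (u : ℕ) < d then z u else 1)]
  simp only [sum_factor_mul, Finset.prod_mul_distrib, Finset.prod_const, Finset.card_univ,
    Fintype.card_fin, indicatorPoly]
  rw [Finset.prod_range]

/-- The constant ones contribute 2n, the constant zeros -n, and the shift on the data rows another
-n; these cancel. Divided by 3n, what is left is the unpadded mean. -/
theorem sum_noisyBit (τ : ℕ → ℕ) :
    ∑ i : Fin (n + n + n), (3 * noisyBit d n k x p Z i τ - 1) =
      3 * ∑ i ∈ Finset.range n, keptProd d k x p Z i τ := by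
  rw [Fin.sum_univ_eq_sum_range (fun i => 3 * noisyBit d n k x p Z i τ - 1),
    Finset.sum_range_add, Finset.sum_range_add]
  have h1 : ∀ i ∈ Finset.range n, 3 * noisyBit d n k x p Z i τ - 1 =
      3 * keptProd d k x p Z i τ - 1 := fun i hi => by
    rw [noisyBit, if_pos (Finset.mem_range.1 hi)]
  have h2 : ∀ i ∈ Finset.range n, 3 * noisyBit d n k x p Z (n + i) τ - 1 = 2 := fun i hi => by
    have := Finset.mem_range.1 hi
    rw [noisyBit, if_neg (by omega), if_pos (by omega)]
    norm_num
  have h3 : ∀ i ∈ Finset.range n, 3 * noisyBit d n k x p Z (n + n + i) τ - 1 = -1 := fun i hi => by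
    rw [noisyBit, if_neg (by omega), if_neg (by omega)]
    norm_num
  rw [Finset.sum_congr rfl h1, Finset.sum_congr rfl h2, Finset.sum_congr rfl h3,
    Finset.sum_sub_distrib, ← Finset.mul_sum]
  simp
  ring

/-- The mean of the contribution of a round. -/
theorem sum_seedEstimate (hn : 0 < n) :
    ∑ a : Seed n d k, seedEstimate x p Z σ a = Fintype.card (Seed n d k) *
      ((∑ i ∈ Finset.range n, (if missProb d p Z i < x then 0 else 1) *
        indicatorPoly k (∑ j ∈ Finset.range d, Z i j * σ j)) / n) := by
  have hn' : (n : ℝ) ≠ 0 := by exact_mod_cast hn.ne'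
  rw [Fintype.sum_prod_type_right]
  have h : ∀ t : Fin k → Fin (d + 1), ∑ i : Fin (n + n + n), seedEstimate x p Z σ (i, t) =
      ∑ i ∈ Finset.range n, 3 * ((if missProb d p Z i < x then 0 else 1) *
        (tupleFactor d k σ (fun j => if h : j < k then t ⟨j, h⟩ else 0) *
          tupleProd d (Z i) k (fun j => if h : j < k then t ⟨j, h⟩ else 0))) := by
    intro t
    have hs : ∀ i, seedTuple ((i, t) : Seed n d k) =
        fun j => if h : j < k then (t ⟨j, h⟩ : ℕ) else 0 := fun i => rfl
    simp only [seedEstimate, seedNumber, hs]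
    rw [← Finset.mul_sum, sum_noisyBit, Finset.mul_sum, Finset.mul_sum]
    refine Finset.sum_congr rfl fun i _ => ?_
    rw [keptProd]
    ring
  simp only [h]
  rw [Finset.sum_comm]
  simp only [← Finset.mul_sum, sum_tupleFactor_mul]
  simp only [Fintype.card_prod, Fintype.card_fin, Fintype.card_fun]
  push_cast
  rw [Finset.sum_congr rfl fun i _ => mul_left_comm _ _ _, ← Finset.mul_sum]
  field_simp
  ring

theorem abs_seedEstimate_le (hZ : ∀ i j, Z i j = 0 ∨ Z i j = 1) (hσ : ∀ j, σ j = 0 ∨ σ j = 1)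
    (a : Seed n d k) : |seedEstimate x p Z σ a| ≤ 2 * ((d : ℝ) + 1) ^ k := by
  have h1 : |seedNumber x p Z a| ≤ 2 := by
    rw [seedNumber]
    rcases noisyBit_mem (d := d) (n := n) (k := k) (x := x) (p := p) hZ a.1 (seedTuple a) with h | h
      <;> rw [h] <;> norm_num
  have h2 : |tupleFactor d k σ (seedTuple a)| ≤ ((d : ℝ) + 1) ^ k := by
    rw [tupleFactor, Finset.abs_prod]
    calc _ ≤ ∏ _j ∈ Finset.range k, ((d : ℝ) + 1) := by
          refine Finset.prod_le_prod (fun _ _ => abs_nonneg _) fun j _ => ?_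
          have hd : (0 : ℝ) ≤ (d : ℝ) + 1 := by positivity
          rw [factor]
          split_ifs
          · rw [zero_sub, abs_neg]
            rcases hσ (seedTuple a j) with h | h <;> rw [h]
            · simpa using hd
            · rw [one_mul, abs_of_nonneg (by positivity)]
              exact div_le_self hd (by linarith [(j.cast_nonneg : (0 : ℝ) ≤ j)])
          · rw [abs_of_nonneg hd]
      _ = _ := by simp
  rw [seedEstimate, abs_mul, mul_comm 2]
  exact mul_le_mul h2 h1 (abs_nonneg _) (by positivity)

end Estimator

/-! ### Privacy -/

/-- The output memory that holds given records. -/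
noncomputable def decode {d k m : ℕ} (ρ : Fin m → ℝ × (Fin k → Fin (d + 1))) (q : ℕ) : ℝ :=
  if h : q < m * (k + 1) then
    if h' : q % (k + 1) < k then ((ρ ⟨q / (k + 1), Nat.div_lt_of_lt_mul (by rwa [mul_comm])⟩).2
      ⟨q % (k + 1), h'⟩ : ℕ)
    else (ρ ⟨q / (k + 1), Nat.div_lt_of_lt_mul (by rwa [mul_comm])⟩).1
  else 0

/-- The record that is released in a round. -/
noncomputable def seedRecord {d n k : ℕ} (x : ℝ) (p : ℕ → ℝ) (Z : ℕ → ℕ → ℝ) (a : Seed n d k) :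
    ℝ × (Fin k → Fin (d + 1)) :=
  (seedNumber x p Z a, a.2)

/-- The synopsis depends on the random choices only through the records of the rounds, so privacy
need only be shown for these. -/
theorem outPrefix_eq_decode {d n k m : ℕ} {x : ℝ} {p : ℕ → ℝ} {Z : ℕ → ℕ → ℝ} (hn : 0 < n)
    (ω : Tape) : outPrefix d n k x p Z ω (m * (k + 1)) =
      decode (seedRecord x p Z ∘ seeds hn d k m ω) := by
  ext q
  rw [outPrefix, decode]
  by_cases h : q < m * (k + 1)
  · rw [if_pos h, dif_pos h, outCell]
    by_cases h' : q % (k + 1) < k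
    · rw [if_pos h', dif_pos h']
      simp only [Function.comp, seedRecord, seeds]
      congr 2
      have := Nat.div_add_mod' q (k + 1)
      omega
    · rw [if_neg h', dif_neg h']
      simp only [Function.comp, seedRecord, seedNumber, seeds]
      congr 2
      refine noisyBit_congr_tuple fun j hj => ?_
      simp [seedTuple, hj]
  · rw [if_neg h, dif_neg h]

/-- Changing one of the sampled values hardly changes the frequency of a value. -/
theorem card_fiber_le {n : ℕ} (hn : 0 < n) {f g : Fin (n + n + n) → ℝ}
    (hf : ∀ i, f i = -1 ∨ f i = 2) (h2 : ∀ i : Fin (n + n + n), n ≤ i → (i : ℕ) < n + n → g i = 2)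
    (h1 : ∀ i : Fin (n + n + n), n + n ≤ i → g i = -1) {i₀ : Fin (n + n + n)}
    (hfg : ∀ i, i ≠ i₀ → f i = g i) (v : ℝ) :
    (Fintype.card {i // f i = v} : ℝ) ≤ (1 + 1 / n) * Fintype.card {i // g i = v} := by
  have hn' : (0 : ℝ) < n := by exact_mod_cast hn
  by_cases hv : v = -1 ∨ v = 2
  · have hle : Fintype.card {i // f i = v} ≤ Fintype.card {i // g i = v} + 1 := by
      rw [Fintype.card_subtype, Fintype.card_subtype]
      refine (Finset.card_le_card ?_).trans (Finset.card_insert_le i₀ _)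
      intro i hi
      rw [Finset.mem_insert]
      by_cases h : i = i₀
      · exact Or.inl h
      · right
        simpa [← hfg i h] using hi
    have hge : n ≤ Fintype.card {i // g i = v} := by
      rcases hv with rfl | rfl
      · have := Fintype.card_le_of_injective (α := Fin n)
          (fun i => (⟨⟨n + n + i, by omega⟩, h1 _ (by simp)⟩ : {i // g i = -1}))
          fun i j h => by simpa [Fin.ext_iff] using h
        simpa using this
      · have := Fintype.card_le_of_injective (α := Fin n)
          (fun i => (⟨⟨n + i, by omega⟩, h2 _ (by simp) (by simp)⟩ : {i // g i = 2}))
          fun i j h => by simpa [Fin.ext_iff] using h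
        simpa using this
    -- The padding keeps the fibre of `g` at size n or more, so one additional element costs a
    -- factor of at most 1 + 1/n.
    have hle' : (Fintype.card {i // f i = v} : ℝ) ≤ Fintype.card {i // g i = v} + 1 := by
      exact_mod_cast hle
    have hge' : (n : ℝ) ≤ Fintype.card {i // g i = v} := by exact_mod_cast hge
    have : 1 ≤ 1 / (n : ℝ) * Fintype.card {i // g i = v} := by
      rw [one_div, ← div_eq_inv_mul, le_div_iff₀ hn']
      linarith
    linarith
  · have : IsEmpty {i // f i = v} := ⟨fun i => hv (by rw [← i.2]; exact hf i.1)⟩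
    rw [Fintype.card_eq_zero]
    simp only [Nat.cast_zero]
    positivity

-- The tuple is part of the record and is drawn independently of the data. Once it is fixed, only
-- the row varies and `card_fiber_le` applies.
open Classical in
theorem card_seedRecord_le {d n k : ℕ} {x : ℝ} {p : ℕ → ℝ} {Z Z' : ℕ → ℕ → ℝ} (hn : 0 < n)
    (hZ : ∀ i j, Z i j = 0 ∨ Z i j = 1) {i₀ : ℕ} (hi₀ : i₀ < n)
    (hZZ : ∀ i < n, i ≠ i₀ → Z i = Z' i) (ρ : ℝ × (Fin k → Fin (d + 1))) :
    (Nat.card {a : Seed n d k // seedRecord x p Z a = ρ} : ℝ) ≤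
      (1 + 1 / n) * Nat.card {a : Seed n d k // seedRecord x p Z' a = ρ} := by
  simp only [Nat.card_eq_fintype_card]
  have e : ∀ Z : ℕ → ℕ → ℝ, Fintype.card {a : Seed n d k // seedRecord x p Z a = ρ} =
      Fintype.card {i : Fin (n + n + n) // seedNumber x p Z ((i, ρ.2) : Seed n d k) = ρ.1} := by
    intro Z
    refine Fintype.card_congr ⟨fun a => ⟨a.1.1, ?_⟩, fun i => ⟨(i.1, ρ.2), Prod.ext i.2 rfl⟩,
      fun a => ?_, fun i => rfl⟩
    · have h := a.2
      rw [seedRecord, Prod.ext_iff] at h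
      rw [← h.1, ← h.2]
    · have h := a.2
      rw [seedRecord, Prod.ext_iff] at h
      exact Subtype.ext (Prod.ext rfl h.2.symm)
  rw [e, e]
  refine card_fiber_le hn (i₀ := ⟨i₀, by omega⟩) (fun i => ?_) (fun i h h' => ?_) (fun i h => ?_)
    (fun i hi => ?_) _
  · rw [seedNumber]
    rcases noisyBit_mem (d := d) (n := n) (k := k) (x := x) (p := p) hZ i
      (seedTuple ((i, ρ.2) : Seed n d k)) with h | h <;> rw [h] <;> norm_num
  · rw [seedNumber, noisyBit, if_neg (by simpa using h), if_pos (by simpa using h')]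
    norm_num
  · rw [seedNumber, noisyBit, if_neg (by simp; omega), if_neg (by simpa using h)]
    norm_num
  · rw [seedNumber, seedNumber, noisyBit_congr_row fun h => hZZ _ h fun h' => hi (Fin.ext h')]

/-! ### Privacy of the synopsis -/

section Main

variable {α β ε : ℝ} {d : ℕ} {μ : Fin d → Measure Bool} {a b a' b' : ℚ}

/-- The literals `a + b x` of the data set, as rows of zeros and ones. -/
noncomputable def literal (a b : ℚ) {d n : ℕ} (D : Fin n → Fin d → Bool) (i j : ℕ) : ℝ :=
  a + b * if h : i < n then bitRow (D ⟨i, h⟩) j else 0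

theorem bitRow_eq_bit (x : Fin d → Bool) (j : ℕ) : ∃ c, bitRow x j = bit c := by
  rw [bitRow]
  split_ifs with h h'
  · exact ⟨true, by simp [bit]⟩
  · exact ⟨false, by simp [bit]⟩
  · exact ⟨false, by simp [bit]⟩

theorem literal_mem (hab : ∀ c, (a : ℝ) + b * bit c = 0 ∨ (a : ℝ) + b * bit c = 1) {n : ℕ}
    (D : Fin n → Fin d → Bool) (i j : ℕ) : literal a b D i j = 0 ∨ literal a b D i j = 1 := by
  rw [literal]
  split_ifs with h
  · obtain ⟨c, hc⟩ := bitRow_eq_bit (D ⟨i, h⟩) j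
    rw [hc]
    exact hab c
  · simpa [bit] using hab false

theorem exec_release (α β ε : ℝ) (μ : Fin d → Measure Bool) (a b : ℚ) {n : ℕ}
    (D : Fin n → Fin d → Bool) (ω : Tape) :
    ∃ (m : ℕ) (s : State), Exec (releaseInput α β ε μ D) ω (releaseProg a b)
        (releaseInput α β ε μ D).start m s ∧
      m ≤ releaseTime d (degree (cutoff α β)) ⌈sampleBound d (cutoff α β)⌉₊ ∧
      s.out = if sampleBound d (cutoff α β) + 1 < n * ε then
        outPrefix d n (degree (cutoff α β)) (cutoff α β) (marginalRow μ) (literal a b D) ω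
          (⌈sampleBound d (cutoff α β)⌉₊ * (degree (cutoff α β) + 1))
        else 0 := by
  have h1 : (releaseInput α β ε μ D).table 1 0 = marginalRow μ := by
    ext j; simp [releaseInput]
  have h2 : (fun i j => (a : ℝ) + b * (releaseInput α β ε μ D).table 0 i j) = literal a b D := by
    ext i j
    simp only [releaseInput, literal, if_true]
  have := runs_release (inp := releaseInput α β ε μ D) (ω := ω) (d := d) (n := n) (ε := ε) (a := a)
    (b := b) (α := α) (β := β) rfl rfl rfl rfl rfl rfl
  rwa [releaseOut, h1, h2] at this

theorem synopsis_eq (α β ε : ℝ) (μ : Fin d → Measure Bool) (a b : ℚ) {n : ℕ}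
    (D : Fin n → Fin d → Bool) (ω : Tape) :
    synopsis (releaseProg a b) α β ε μ n D ω =
      if sampleBound d (cutoff α β) + 1 < n * ε then
        outPrefix d n (degree (cutoff α β)) (cutoff α β) (marginalRow μ) (literal a b D) ω
          (⌈sampleBound d (cutoff α β)⌉₊ * (degree (cutoff α β) + 1))
        else 0 := by
  obtain ⟨m, s, he, -, ho⟩ := exec_release α β ε μ a b D ω
  rw [synopsis, Prog.output_eq he, ho]

theorem pos_of_lt_mul {x : ℝ} (hx : 0 < x) {n : ℕ} (h : x < n * ε) : 0 < n := by
  rcases Nat.eq_zero_or_pos n with rfl | h'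
  · rw [Nat.cast_zero, zero_mul] at h
    linarith
  · exact h'

theorem isDifferentiallyPrivate_release (hα : 0 < α) (hβ : 0 < β) (hε : 0 < ε)
    (hab : ∀ c, (a : ℝ) + b * bit c = 0 ∨ (a : ℝ) + b * bit c = 1) :
    IsDifferentiallyPrivate ε (synopsis (releaseProg a b) α β ε μ) := by
  classical
  rintro n D D' ⟨i₀, hi₀⟩ E -
  simp only [synopsis_eq]
  set x := cutoff α β with hx
  set k := degree x with hk
  set m := ⌈sampleBound d x⌉₊ with hm
  have hx0 : 0 < x := cutoff_pos hα hβ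
  have hS : 0 < sampleBound d x := sampleBound_pos hx0
  -- The size test depends only on n and the parameters, so adjacent data sets take the same branch.
  by_cases hc : sampleBound d x + 1 < n * ε
  · have hn : 0 < n := pos_of_lt_mul (by linarith) hc
    have hn' : (0 : ℝ) < n := by exact_mod_cast hn
    simp only [hc, if_true, outPrefix_eq_decode hn]
    have hrow : ∀ i < n, i ≠ i₀ → literal a b D i = literal a b D' i := by
      intro i hi hne
      ext j
      rw [literal, literal, dif_pos hi, dif_pos hi, hi₀ ⟨i, hi⟩ fun h => hne (by rw [← h])]
    have hcard := card_filter_comp_le (seedRecord (d := d) (n := n) (k := k) x (marginalRow μ)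
      (literal a b D)) (seedRecord x (marginalRow μ) (literal a b D')) (c := 1 + 1 / n)
      (card_seedRecord_le hn (literal_mem hab D) i₀.2 hrow) m {ρ | decode ρ ∈ E}
    -- The test allows for rounding up: m < sampleBound + 1 < nε, so m/n ≤ ε.
    have hexp : (1 + 1 / (n : ℝ)) ^ m ≤ Real.exp ε := by
      have h1 : 1 + 1 / (n : ℝ) ≤ Real.exp (1 / n) := by
        rw [add_comm]; exact Real.add_one_le_exp _
      calc (1 + 1 / (n : ℝ)) ^ m ≤ Real.exp (1 / n) ^ m := by gcongr
        _ = Real.exp (m * (1 / n)) := (Real.exp_nat_mul _ _).symm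
        _ ≤ Real.exp ε := by
          rw [Real.exp_le_exp, mul_one_div, div_le_iff₀ hn', mul_comm]
          exact ((Nat.ceil_lt_add_one hS.le).trans hc).le
    have hreal : tapeMeasure.real {ω | decode (seedRecord x (marginalRow μ) (literal a b D) ∘
          seeds hn d k m ω) ∈ E} ≤
        Real.exp ε * tapeMeasure.real {ω | decode (seedRecord x (marginalRow μ) (literal a b D') ∘
          seeds hn d k m ω) ∈ E} := by
      rw [tapeMeasure_seeds_mem hn (m := m) (k := k) fun s =>
          decode (seedRecord x (marginalRow μ) (literal a b D) ∘ s) ∈ E,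
        tapeMeasure_seeds_mem hn (m := m) (k := k) fun s =>
          decode (seedRecord x (marginalRow μ) (literal a b D') ∘ s) ∈ E, ← mul_div_assoc]
      refine div_le_div_of_nonneg_right ?_ (by positivity)
      exact hcard.trans (mul_le_mul_of_nonneg_right hexp (Nat.cast_nonneg _))
    rw [← ofReal_measureReal, ← ofReal_measureReal, ← ENNReal.ofReal_mul (Real.exp_pos _).le]
    exact ENNReal.ofReal_le_ofReal hreal
  · simp only [hc, if_false]
    refine le_mul_of_one_le_left zero_le ?_
    rw [ENNReal.one_le_ofReal]
    exact Real.one_le_exp hε.le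

/-! ### Accuracy -/

theorem bitRow_val (S : Fin d → Bool) (j : Fin d) : bitRow S j = bit (S j) := by
  simp [bitRow, bit]

theorem marginalRow_val (j : Fin d) : marginalRow μ j = (μ j).real {true} := by
  simp [marginalRow]

theorem exec_answer (α β ε : ℝ) (μ : Fin d → Measure Bool) (a b a' b' : ℚ) {n : ℕ}
    (D : Fin n → Fin d → Bool) (ω : Tape) (S : Fin d → Bool) :
    ∃ (l : ℕ) (s : State),
      Exec (answerInput α β ε μ (synopsis (releaseProg a b) α β ε μ n D ω) S) zeroTape
        (answerProg a' b')
        (answerInput α β ε μ (synopsis (releaseProg a b) α β ε μ n D ω) S).start l s ∧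
      l ≤ releaseTime d (degree (cutoff α β)) ⌈sampleBound d (cutoff α β)⌉₊ ∧
      (sampleBound d (cutoff α β) + 1 < n * ε → ∀ hn : 0 < n,
        s.out 0 = a' + b' * ((∑ r, seedEstimate (cutoff α β) (marginalRow μ) (literal a b D)
          (bitRow S) (seeds hn d (degree (cutoff α β)) ⌈sampleBound d (cutoff α β)⌉₊ ω r)) /
            (⌈sampleBound d (cutoff α β)⌉₊ : ℕ))) := by
  set x := cutoff α β with hx
  set k := degree x with hk
  set m := ⌈sampleBound d x⌉₊ with hm
  have hσ : ∀ y, (answerInput α β ε μ y S).table 0 0 = bitRow S := by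
    intro y; ext j; simp [answerInput]
  have hy : ∀ y, (answerInput α β ε μ y S).table 2 0 = y := by
    intro y; ext j; simp [answerInput]
  rw [synopsis_eq, ← hx, ← hk, ← hm]
  by_cases hc : sampleBound d x + 1 < n * ε
  · have hlt : ∀ u < k + 1, ∀ r < m, r * (k + 1) + u < m * (k + 1) := by
      intro u hu r hr
      calc r * (k + 1) + u < r * (k + 1) + (k + 1) := by omega
        _ = (r + 1) * (k + 1) := by ring
        _ ≤ m * (k + 1) := Nat.mul_le_mul_right _ hr
    rw [if_pos hc]
    set y := outPrefix d n k x (marginalRow μ) (literal a b D) ω (m * (k + 1)) with hyd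
    obtain ⟨l, s, he, hl, ho⟩ := runs_answer (a := a') (b := b') (ω := zeroTape)
      (inp := answerInput α β ε μ y S) (d := d) (ε := ε) (x := x)
      (τ := fun r j => draw ω (r * (k + 1) + 1 + j) (d + 1))
      (v := fun r => 3 * noisyBit d n k x (marginalRow μ) (literal a b D)
        (draw ω (r * (k + 1)) (n + n + n)) (fun j => draw ω (r * (k + 1) + 1 + j) (d + 1)) - 1)
      rfl rfl rfl rfl rfl rfl
      (fun r hr j hj => ⟨by
        rw [hy, hyd, outPrefix, if_pos (hlt j (by omega) r hr), outCell_tuple _ _ _ _ _ _ _ hj],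
        Nat.lt_succ_iff.1 (draw_lt _ _ d.succ_pos)⟩)
      (fun r hr => by rw [hy, hyd, outPrefix, if_pos (hlt k (by omega) r hr), outCell_bit])
    refine ⟨l, s, he, hl, fun _ hn => ?_⟩
    rw [ho, hσ, estimate, Finset.sum_range]
    congr 3
    refine Finset.sum_congr rfl fun r _ => ?_
    have hτ : ∀ j < k, draw ω (r * (k + 1) + 1 + j) (d + 1) =
        seedTuple (seeds hn d k m ω r) j := by
      intro j hj
      simp [seedTuple, hj, seeds]
    rw [seedEstimate, seedNumber]
    congr 1
    · exact Finset.prod_congr rfl fun j hj => congrArg _ (hτ j (Finset.mem_range.1 hj))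
    · rw [noisyBit_congr_tuple hτ]
      rfl
  · rw [if_neg hc]
    -- The synopsis is all zeros, which is read as tuples of zeros with number zero; only the
    -- running time is of interest here.
    obtain ⟨l, s, he, hl, ho⟩ := runs_answer (a := a') (b := b') (ω := zeroTape)
      (inp := answerInput α β ε μ 0 S) (d := d) (ε := ε) (x := x) (τ := 0) (v := 0)
      rfl rfl rfl rfl rfl rfl
      (fun r hr j hj => by simp [hy]) (fun r hr => by simp [hy])
    exact ⟨l, s, he, hl, fun h => absurd h hc⟩

/-! ### Mean squared error over the query and the random choices -/

/-- The fraction of the entries of the data set in which no literal of a query holds. -/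
noncomputable def missFraction (Z : ℕ → ℕ → ℝ) (d : ℕ) (σ : ℕ → ℝ) (n : ℕ) : ℝ :=
  (∑ i ∈ Finset.range n, ∏ j ∈ Finset.range d, (1 - Z i j * σ j)) / n

/-- The mean of the estimate of `missFraction`. -/
noncomputable def approxFraction (x : ℝ) (k : ℕ) (p : ℕ → ℝ) (Z : ℕ → ℕ → ℝ) (d : ℕ) (σ : ℕ → ℝ)
    (n : ℕ) : ℝ :=
  (∑ i ∈ Finset.range n, (if missProb d p Z i < x then 0 else 1) *
    indicatorPoly k (∑ j ∈ Finset.range d, Z i j * σ j)) / n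

/-- The probability of a query. -/
noncomputable def queryProb (μ : Fin d → Measure Bool) (S : Fin d → Bool) : ℝ :=
  ∏ i, (μ i).real {S i}

theorem queryProb_nonneg (S : Fin d → Bool) : 0 ≤ queryProb μ S :=
  Finset.prod_nonneg fun _ _ => measureReal_nonneg

theorem countingQuery_eq {q : QueryFamily}
    (hq : ∀ S y, q d S y = a' + b' * ∏ i, (1 - ((a : ℝ) + b * bit (y i)) * bit (S i)))
    {n : ℕ} (hn : 0 < n) (D : Fin n → Fin d → Bool) (S : Fin d → Bool) :
    countingQuery (q d S) D = a' + b' * missFraction (literal a b D) d (bitRow S) n := by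
  have hn' : (n : ℝ) ≠ 0 := by exact_mod_cast hn.ne'
  have h : ∀ i : Fin n, q d S (D i) =
      a' + b' * ∏ j ∈ Finset.range d, (1 - literal a b D i j * bitRow S j) := by
    intro i
    rw [hq, Finset.prod_range]
    simp [literal, bitRow_val]
  rw [countingQuery, missFraction, Finset.sum_range]
  simp only [h, Finset.sum_add_distrib, ← Finset.mul_sum, Finset.sum_const, Finset.card_univ,
    Fintype.card_fin, nsmul_eq_mul]
  field_simp

variable [∀ i, IsProbabilityMeasure (μ i)]

theorem real_true_add_false (i : Fin d) : (μ i).real {true} + (μ i).real {false} = 1 := by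
  have h := sum_measureReal_singleton (μ := μ i) (Finset.univ : Finset Bool)
  rw [Finset.coe_univ, probReal_univ] at h
  simpa using h

theorem sum_queryProb : ∑ S, queryProb μ S = 1 := by
  have h := sum_prod_bits (fun i c => (μ i).real {c}) fun _ _ => 1
  simp only [Finset.prod_const_one, mul_one, real_true_add_false] at h
  exact h

/-- By Cauchy–Schwarz the squared mean of the errors of the entries is at most the mean of their
squares, and `approx_error` bounds each entry separately. -/
theorem sum_sq_approxFraction_sub_le {n : ℕ} (hn : 0 < n) {Z : ℕ → ℕ → ℝ}
    (hZ : ∀ i j, Z i j = 0 ∨ Z i j = 1) {x : ℝ} (hx : 0 < x) {k : ℕ} (hk : (1 / x) ^ 8 ≤ 2 ^ k) :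
    ∑ S, queryProb μ S * (approxFraction x k (marginalRow μ) Z d (bitRow S) n -
      missFraction Z d (bitRow S) n) ^ 2 ≤ x := by
  have hn' : (0 : ℝ) < n := by exact_mod_cast hn
  set e : ℕ → (Fin d → Bool) → ℝ := fun i S => ∏ j : Fin d, (1 - Z i j * bit (S j)) -
    (if ∏ j : Fin d, (1 - Z i j * (μ j).real {true}) < x then 0 else 1) *
      indicatorPoly k (∑ j : Fin d, Z i j * bit (S j)) with he
  have h1 : ∀ S, (approxFraction x k (marginalRow μ) Z d (bitRow S) n -
      missFraction Z d (bitRow S) n) ^ 2 ≤ (∑ i ∈ Finset.range n, e i S ^ 2) / n := by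
    intro S
    have h : approxFraction x k (marginalRow μ) Z d (bitRow S) n -
        missFraction Z d (bitRow S) n = -((∑ i ∈ Finset.range n, e i S) / n) := by
      rw [approxFraction, missFraction, ← sub_div, ← Finset.sum_sub_distrib, ← neg_div,
        ← Finset.sum_neg_distrib]
      congr 1
      refine Finset.sum_congr rfl fun i _ => ?_
      simp only [he, missProb, Finset.prod_range, Finset.sum_range, bitRow_val, marginalRow_val,
        neg_sub]
    rw [h, neg_sq, div_pow, div_le_div_iff₀ (by positivity) hn']
    have := sq_sum_le_card_mul_sum_sq (s := Finset.range n) (f := fun i => e i S)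
    rw [Finset.card_range] at this
    calc _ ≤ (n * ∑ i ∈ Finset.range n, e i S ^ 2) * n := by gcongr
      _ = _ := by ring
  calc _ ≤ ∑ S, queryProb μ S * ((∑ i ∈ Finset.range n, e i S ^ 2) / n) :=
        Finset.sum_le_sum fun S _ => mul_le_mul_of_nonneg_left (h1 S) (queryProb_nonneg S)
    _ = (∑ i ∈ Finset.range n, ∑ S, queryProb μ S * e i S ^ 2) / n := by
        rw [Finset.sum_comm, Finset.sum_div]
        refine Finset.sum_congr rfl fun S _ => ?_
        rw [← Finset.mul_sum, mul_div_assoc]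
    _ ≤ (∑ i ∈ Finset.range n, x) / n := by
        gcongr with i _
        exact approx_error (P := fun j c => (μ j).real {c}) (fun _ _ => measureReal_nonneg)
          real_true_add_false (fun j => hZ i j) hx hk
    _ = x := by
        rw [Finset.sum_const, Finset.card_range, nsmul_eq_mul]
        field_simp

/-- The mean squared error of the estimate, for a given random choice. -/
noncomputable def queryError {n k m : ℕ} (μ : Fin d → Measure Bool) (x : ℝ) (Z : ℕ → ℕ → ℝ)
    (s : Fin m → Seed n d k) : ℝ :=
  ∑ S, queryProb μ S * ((∑ r, seedEstimate x (marginalRow μ) Z (bitRow S) (s r)) / m -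
    missFraction Z d (bitRow S) n) ^ 2

theorem sum_queryError_le {n : ℕ} (hn : 0 < n) {Z : ℕ → ℕ → ℝ}
    (hZ : ∀ i j, Z i j = 0 ∨ Z i j = 1) {x : ℝ} (hx : 0 < x) :
    ∑ s : Fin ⌈sampleBound d x⌉₊ → Seed n d (degree x), queryError μ x Z s ≤
      4 * x * (Fintype.card (Seed n d (degree x)) : ℝ) ^ ⌈sampleBound d x⌉₊ := by
  set k := degree x with hk
  set m := ⌈sampleBound d x⌉₊ with hm
  have hS : 0 < sampleBound d x := sampleBound_pos hx
  have hm0 : 0 < m := Nat.ceil_pos.2 hS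
  have hm' : (0 : ℝ) < m := by exact_mod_cast hm0
  -- The sample size is chosen for this: 4(d+1)^(2k) is exactly x times `sampleBound`.
  have hvar : (2 * ((d : ℝ) + 1) ^ k) ^ 2 / m ≤ x := by
    rw [div_le_iff₀ hm']
    calc (2 * ((d : ℝ) + 1) ^ k) ^ 2 = x * sampleBound d x := by
          rw [sampleBound, ← hk, mul_pow ((d : ℝ) + 1)]
          field_simp
          ring
      _ ≤ x * m := by
          gcongr
          exact Nat.le_ceil _
  have : Nonempty (Seed n d k) := ⟨(⟨0, by omega⟩, fun _ => 0)⟩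
  set N : ℝ := (Fintype.card (Seed n d k) : ℝ) ^ m with hN
  have hN0 : 0 ≤ N := by positivity
  have hbit : ∀ (S : Fin d → Bool) j, bitRow S j = 0 ∨ bitRow S j = 1 := by
    intro S j
    obtain ⟨c, hc⟩ := bitRow_eq_bit S j
    rw [hc]
    exact bit_eq c
  simp only [queryError]
  rw [Finset.sum_comm]
  simp only [← Finset.mul_sum]
  calc _ ≤ ∑ S, queryProb μ S * ((2 * (approxFraction x k (marginalRow μ) Z d (bitRow S) n -
            missFraction Z d (bitRow S) n) ^ 2 + 2 * ((2 * ((d : ℝ) + 1) ^ k) ^ 2 / m)) * N) := by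
        refine Finset.sum_le_sum fun S _ => mul_le_mul_of_nonneg_left ?_ (queryProb_nonneg S)
        exact sum_sq_mean_sub_le _ (sum_seedEstimate hn)
          (abs_seedEstimate_le hZ (hbit S)) _ hm0
    _ ≤ ∑ S, queryProb μ S * ((2 * (approxFraction x k (marginalRow μ) Z d (bitRow S) n -
            missFraction Z d (bitRow S) n) ^ 2 + 2 * x) * N) := by
        gcongr with S _
        exact queryProb_nonneg S
    _ = (2 * (∑ S, queryProb μ S * (approxFraction x k (marginalRow μ) Z d (bitRow S) n -
            missFraction Z d (bitRow S) n) ^ 2) + 2 * x * ∑ S, queryProb μ S) * N := by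
        rw [Finset.mul_sum, Finset.mul_sum, ← Finset.sum_add_distrib, Finset.sum_mul]
        exact Finset.sum_congr rfl fun S _ => by ring
    _ ≤ (2 * x + 2 * x * 1) * N := by
        rw [sum_queryProb]
        gcongr
        exact sum_sq_approxFraction_sub_le hn hZ hx (degree_spec x)
    _ = _ := by ring

/-- Chebyshev's inequality over the query; an affine map of slope at most one in absolute value does
not enlarge errors. -/
theorem releases_of_queryError_le {q : QueryFamily} (hα : 0 < α)
    {n : ℕ} {D : Fin n → Fin d → Bool} {ans est tr : (Fin d → Bool) → ℝ} (hb : |(b' : ℝ)| ≤ 1)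
    (htr : ∀ S, countingQuery (q d S) D = a' + b' * tr S)
    (hans : ∀ S, ans S = a' + b' * est S)
    (h : ∑ S, queryProb μ S * (est S - tr S) ^ 2 ≤ α ^ 2 * β) :
    Releases α β (q d) D (Measure.pi μ) ans := by
  rw [Releases]
  have hcompl := probReal_compl_eq_one_sub (μ := Measure.pi μ)
    (Set.toFinite {S | |countingQuery (q d S) D - ans S| ≤ α}).measurableSet
  have hbad : (Measure.pi μ).real {S | |countingQuery (q d S) D - ans S| ≤ α}ᶜ ≤ β := by
    classical
    have hset : {S | |countingQuery (q d S) D - ans S| ≤ α}ᶜ =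
        ((Finset.univ.filter fun S => ¬ |countingQuery (q d S) D - ans S| ≤ α : Finset _) :
          Set (Fin d → Bool)) := by
      ext S; simp
    rw [hset, ← sum_measureReal_singleton]
    have hα2 : 0 < α ^ 2 := by positivity
    refine le_of_mul_le_mul_left ?_ hα2
    refine le_trans ?_ h
    rw [Finset.mul_sum]
    refine (Finset.sum_le_sum fun S hS => ?_).trans
      (Finset.sum_le_sum_of_subset_of_nonneg (Finset.filter_subset _ _) fun S _ _ =>
        mul_nonneg (queryProb_nonneg S) (sq_nonneg _))
    have hp : (Measure.pi μ).real {S} = queryProb μ S := by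
      rw [Measure.real, Measure.pi_singleton, ENNReal.toReal_prod]
      rfl
    rw [hp, mul_comm]
    refine mul_le_mul_of_nonneg_left ?_ (queryProb_nonneg S)
    have h1 : α < |countingQuery (q d S) D - ans S| := not_le.1 (Finset.mem_filter.1 hS).2
    have h2 : |countingQuery (q d S) D - ans S| ≤ |est S - tr S| := by
      rw [htr, hans, add_sub_add_left_eq_sub, ← mul_sub, abs_mul, abs_sub_comm]
      exact mul_le_of_le_one_left (abs_nonneg _) hb
    rw [← sq_abs (est S - tr S)]
    gcongr
    exact h1.le.trans h2
  linarith

/-- Markov's inequality over the random choices: `queryError` has mean at most 4x = α²β², so it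
exceeds α²β with probability at most β. -/
theorem accuracy_release {q : QueryFamily} (hα : 0 < α) (hβ : 0 < β)
    (hab : ∀ c, (a : ℝ) + b * bit c = 0 ∨ (a : ℝ) + b * bit c = 1) (hb : |(b' : ℝ)| ≤ 1)
    (hq : ∀ S y, q d S y = a' + b' * ∏ i, (1 - ((a : ℝ) + b * bit (y i)) * bit (S i)))
    {n : ℕ} (D : Fin n → Fin d → Bool) (hc : sampleBound d (cutoff α β) + 1 < n * ε) :
    1 - β ≤ tapeMeasure.real {ω | Releases α β (q d) D (Measure.pi μ)
      (answer (answerProg a' b') α β ε μ (synopsis (releaseProg a b) α β ε μ n D ω))} := by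
  classical
  set x := cutoff α β with hx
  set k := degree x with hk
  set m := ⌈sampleBound d x⌉₊ with hm
  have hx0 : 0 < x := cutoff_pos hα hβ
  have hn : 0 < n := pos_of_lt_mul (by linarith [sampleBound_pos (d := d) hx0]) hc
  set Z := literal a b D with hZ
  set N : ℝ := (Fintype.card (Seed n d k) : ℝ) ^ m with hN
  have : Nonempty (Seed n d k) := ⟨(⟨0, by omega⟩, fun _ => 0)⟩
  have hN0 : 0 < N := by positivity
  have hgood : tapeMeasure.real {ω | queryError μ x Z (seeds hn d k m ω) ≤ α ^ 2 * β} ≤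
      tapeMeasure.real {ω | Releases α β (q d) D (Measure.pi μ)
        (answer (answerProg a' b') α β ε μ (synopsis (releaseProg a b) α β ε μ n D ω))} := by
    refine measureReal_mono fun ω hω => ?_
    refine releases_of_queryError_le (a' := a') hα hb (countingQuery_eq hq hn D) (fun S => ?_) hω
    obtain ⟨l, s, he, -, ho⟩ := exec_answer α β ε μ a b a' b' D ω S
    rw [answer, Prog.output_eq he, ho hc hn]
  refine le_trans ?_ hgood
  rw [tapeMeasure_seeds_mem hn (m := m) (k := k) fun s => queryError μ x Z s ≤ α ^ 2 * β,
    le_div_iff₀ hN0]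
  have hsum := Finset.card_filter_add_card_filter_not (s := (Finset.univ : Finset (Fin m → Seed n d k)))
    (fun s => queryError μ x Z s ≤ α ^ 2 * β)
  rw [Finset.card_univ, Fintype.card_fun, Fintype.card_fin] at hsum
  have hsum' : ((Finset.univ.filter fun s : Fin m → Seed n d k =>
        queryError μ x Z s ≤ α ^ 2 * β).card : ℝ) +
      (Finset.univ.filter fun s : Fin m → Seed n d k =>
        ¬ queryError μ x Z s ≤ α ^ 2 * β).card = N := by
    rw [hN]; exact_mod_cast hsum
  have hbad : ((Finset.univ.filter fun s : Fin m → Seed n d k =>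
      ¬ queryError μ x Z s ≤ α ^ 2 * β).card : ℝ) ≤ β * N := by
    have hαβ : 0 < α ^ 2 * β := by positivity
    refine le_of_mul_le_mul_right ?_ hαβ
    calc _ = ∑ _s ∈ Finset.univ.filter fun s : Fin m → Seed n d k =>
            ¬ queryError μ x Z s ≤ α ^ 2 * β, α ^ 2 * β := by
          rw [Finset.sum_const, nsmul_eq_mul]
      _ ≤ ∑ s ∈ Finset.univ.filter fun s : Fin m → Seed n d k =>
            ¬ queryError μ x Z s ≤ α ^ 2 * β, queryError μ x Z s :=
          Finset.sum_le_sum fun s hs => (not_le.1 (Finset.mem_filter.1 hs).2).le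
      _ ≤ ∑ s : Fin m → Seed n d k, queryError μ x Z s :=
          Finset.sum_le_sum_of_subset_of_nonneg (Finset.filter_subset _ _) fun s _ _ =>
            Finset.sum_nonneg fun S _ => mul_nonneg (queryProb_nonneg S) (sq_nonneg _)
      _ ≤ 4 * x * N := sum_queryError_le hn (literal_mem hab D) hx0
      _ = _ := by rw [hx, cutoff]; ring
  linarith

end Main

/-! ### The two families of queries -/

/-- Every query family that is given by the products of literals can be released. -/
theorem release_of_eq_prod {q : QueryFamily} {a b a' b' : ℚ}
    (hab : ∀ c, (a : ℝ) + b * bit c = 0 ∨ (a : ℝ) + b * bit c = 1) (hb : |(b' : ℝ)| ≤ 1)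
    (hq : ∀ d S y, q d S y = a' + b' * ∏ i, (1 - ((a : ℝ) + b * bit (y i)) * bit (S i))) :
    ∃ P Q : Prog, ∀ α β ε : ℝ, 0 < α → 0 < β → 0 < ε →
      ∀ d : ℕ, 2 ≤ d →
        ∀ μ : Fin d → Measure Bool, (∀ i, IsProbabilityMeasure (μ i)) →
          IsDifferentiallyPrivate ε (synopsis P α β ε μ) ∧
          (∀ (n : ℕ) (D : Fin n → Fin d → Bool) (ω : Tape),
            P.HaltsWithin (releaseInput α β ε μ D) ω ((d : ℝ) ^ timeExponent 400 α β)) ∧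
          (∀ (n : ℕ) (D : Fin n → Fin d → Bool) (ω : Tape) (S : Fin d → Bool),
            Q.HaltsWithin (answerInput α β ε μ (synopsis P α β ε μ n D ω) S) zeroTape
              ((d : ℝ) ^ timeExponent 400 α β)) ∧
          (∀ (n : ℕ) (D : Fin n → Fin d → Bool),
            (d : ℝ) ^ timeExponent 400 α β / ε ≤ (n : ℝ) →
              1 - β ≤ tapeMeasure.real
                {ω | Releases α β (q d) D (Measure.pi μ)
                  (answer Q α β ε μ (synopsis P α β ε μ n D ω))}) := by
  refine ⟨releaseProg a b, answerProg a' b', fun α β ε hα hβ hε d hd μ hμ => ⟨?_, ?_, ?_, ?_⟩⟩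
  · exact isDifferentiallyPrivate_release hα hβ hε hab
  · intro n D ω
    obtain ⟨m, s, he, hm, -⟩ := exec_release α β ε μ a b D ω
    exact ⟨m, s, he, (Nat.cast_le.2 hm).trans (releaseTime_le hα hβ hd)⟩
  · intro n D ω S
    obtain ⟨m, s, he, hm, -⟩ := exec_answer α β ε μ a b a' b' D ω S
    exact ⟨m, s, he, (Nat.cast_le.2 hm).trans (releaseTime_le hα hβ hd)⟩
  · intro n D hn
    rw [div_le_iff₀ hε] at hn
    exact accuracy_release hα hβ hab hb (hq d) D
      (sampleBound_add_one_lt.trans_le ((releaseTime_le hα hβ hd).trans hn))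

theorem mainTheorem3 :
    ∃ C : ℝ, 0 < C ∧
      ∀ q ∈ ({monotoneDisjunctions, monotoneConjunctions} : Set QueryFamily),
        ∃ P Q : Prog, ∀ α β ε : ℝ, 0 < α → 0 < β → 0 < ε →
          ∀ d : ℕ, 2 ≤ d →
            ∀ μ : Fin d → Measure Bool, (∀ i, IsProbabilityMeasure (μ i)) →
              IsDifferentiallyPrivate ε (synopsis P α β ε μ) ∧
              (∀ (n : ℕ) (D : Fin n → Fin d → Bool) (ω : Tape),
                P.HaltsWithin (releaseInput α β ε μ D) ω ((d : ℝ) ^ timeExponent C α β)) ∧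
              (∀ (n : ℕ) (D : Fin n → Fin d → Bool) (ω : Tape) (S : Fin d → Bool),
                Q.HaltsWithin (answerInput α β ε μ (synopsis P α β ε μ n D ω) S) zeroTape
                  ((d : ℝ) ^ timeExponent C α β)) ∧
              (∀ (n : ℕ) (D : Fin n → Fin d → Bool),
                (d : ℝ) ^ timeExponent C α β / ε ≤ (n : ℝ) →
                  1 - β ≤ tapeMeasure.real
                    {ω | Releases α β (q d) D (Measure.pi μ)
                      (answer Q α β ε μ (synopsis P α β ε μ n D ω))}) := by
  refine ⟨400, by norm_num, ?_⟩
  rintro q (rfl | rfl)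
  -- The disjunction is 1 - ∏ (1 - y_i S_i).
  · refine release_of_eq_prod (a := 0) (b := 1) (a' := 1) (b' := -1) (fun c => ?_) (by simp)
      fun d S y => ?_
    · simpa using bit_eq c
    · rw [monotoneDisjunctions]
      split_ifs with h
      · obtain ⟨i, hS, hy⟩ := h
        rw [Finset.prod_eq_zero (Finset.mem_univ i) (by simp [bit, hS, hy])]
        simp
      · push Not at h
        rw [Finset.prod_eq_one fun i _ => ?_]
        · simp
        · cases hS : S i
          · simp [bit]
          · simp [bit, h i hS]
  -- The conjunction is ∏ (1 - (1 - y_i) S_i), with negated literals.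
  · refine release_of_eq_prod (a := 1) (b := -1) (a' := 0) (b' := 1) (fun c => ?_) (by simp)
      fun d S y => ?_
    · rcases bit_eq c with h | h <;> simp [h]
    · rw [monotoneConjunctions]
      split_ifs with h
      · rw [Finset.prod_eq_one fun i _ => ?_]
        · simp
        · cases hS : S i
          · simp [bit]
          · simp [bit, h i hS]
      · push Not at h
        obtain ⟨i, hS, hy⟩ := h
        rw [Finset.prod_eq_zero (Finset.mem_univ i) (by simp [bit, hS, hy])]
        simp
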